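/- Let $\mathbb C_0=\{s\in\mathbb C:\operatorname{Re}s>0\}$, and let $\mathcal A^+$ be the Banach space of absolutely convergent Dirichlet series $f(s)=\sum_{n\ge1}a_n n^{-s}$ with $\|f\|_{\mathcal A^+}=\sum_{n\ge 1}|a_n|<\infty$. Let $\mathcal D$ be the space of analytic functions on $\mathbb C_0$ that are the sum of a convergent Dirichlet series $\sum_{n\ge1}c_n n^{-s}$ for $\operatorname{Re}s$ large enough. Let $\phi:\mathbb C_0\to\mathbb C$ be non-constant and of the form $\phi(s)=c_0s+\varphi(s)$ with $c_0\in\{0,1,2,\dots\}$ and $\varphi\in\mathcal D$, and let $C_\phi f=f\circ\phi$. We say that $C_\phi$ is bounded (resp. compact) on $\mathcal A^+$ if, for all $f\in\mathcal A^+$, the series of $f$ converges absolutely at $\phi(s)$ for every $s\in\mathbb C_0$ and $f\circ\phi\in\mathcal A^+$, and the linear operator $C_\phi:\mathcal A^+\to\mathcal A^+$ is bounded (resp. compact). Let $c_1\in\mathbb C$ and let $(d_j)_{j\ge1}$ be a sequence of complex numbers. **Proposition 2.5.** (a) Let $2\le q_1<q_2<\cdots$ be multiplicatively independent integers (that is,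 the numbers $\log q_j$ are linearly independent over $\mathbb Q$), and suppose that $\varphi(s)=c_1+\sum_{j\ge1}d_jq_j^{-s}$, with convergence, for $\operatorname{Re}s$ large enough. If $C_\phi$ is bounded on $\mathcal A^+$, then $\sum_{j\ge1}|d_j|<\infty$ and $\operatorname{Re}c_1\ge\sum_{j\ge1}|d_j|$. If $C_\phi$ is compact on $\mathcal A^+$, then $\sum_{j\ge1}|d_j|<\infty$ and $\operatorname{Re}c_1>\sum_{j\ge1}|d_j|$. (b) Let $r\ge2$ be an integer and let $(\lambda_j)_{j\ge1}$ be a Sidon set of positive integers: there is a finite constant $C>0$ such that $$\sum_{j=1}^N|a_j|\le C\sup_{t\in\mathbb R}\Big|\sum_{j=1}^Na_je^{i\lambda_jt}\Big|$$ for all $N\ge 1$ and all $a_1,\dots,a_N\in\mathbb C$. Suppose that $\varphi(s)=c_1+\sum_{j\ge1}d_jr^{-\lambda_js}$, with convergence, for $\operatorname{Re}s$ large enough. If $C_\phi$ is bounded on $\mathcal A^+$, then $\sum_{j\ge1}|d_j|<\infty$. -/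

import Mathlib

open Filter Topology

noncomputable section

/-- The open right half-plane `Re s > 0`. -/
def rightHalfPlane : Set ℂ := {s : ℂ | 0 < s.re}

/-- The Wiener-Dirichlet algebra as a Banach space: the Dirichlet series `∑_{n ≥ 1} a_n n^{-s}`
with `‖f‖ = ∑ |a_n| < ∞`, encoded by their coefficient sequences `(a_n)_{n ≥ 1}`
(a Dirichlet series is determined by its coefficients). -/
abbrev WienerDirichlet : Type := lp (fun _ : ℕ+ => ℂ) 1

/-- The value `f(s) = ∑_{n ≥ 1} a_n n^{-s}`. The series converges absolutely for `Re s ≥ 0`. -/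
def WienerDirichlet.eval (f : WienerDirichlet) (s : ℂ) : ℂ :=
  ∑' n : ℕ+, f n * ((n : ℕ) : ℂ) ^ (-s)

/-- `T` is the composition operator with symbol `φ`: for all `f` in the algebra and all `s` with
`Re s > 0`, the series of `f` converges (unconditionally) at `φ(s)`, with sum `(T f)(s)`,
that is, `f(φ(s))` makes sense and `(T f)(s) = f(φ(s))`. -/
def IsCompositionOperator (φ : ℂ → ℂ) (T : WienerDirichlet →L[ℂ] WienerDirichlet) : Prop :=
  ∀ f : WienerDirichlet, ∀ s ∈ rightHalfPlane,
    HasSum (fun n : ℕ+ => f n * ((n : ℕ) : ℂ) ^ (-(φ s))) ((T f).eval s)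

/-- `f ↦ f ∘ φ` is a bounded operator from the Wiener-Dirichlet algebra to itself. -/
def BoundedComposition (φ : ℂ → ℂ) : Prop :=
  ∃ T : WienerDirichlet →L[ℂ] WienerDirichlet, IsCompositionOperator φ T

/-- `f ↦ f ∘ φ` is a compact operator from the Wiener-Dirichlet algebra to itself. -/
def CompactComposition (φ : ℂ → ℂ) : Prop :=
  ∃ T : WienerDirichlet →L[ℂ] WienerDirichlet, IsCompositionOperator φ T ∧ IsCompactOperator T

/-- The space of functions that are analytic on `Re s > 0` and are the sum of a convergent
Dirichlet series `∑_{n ≥ 1} c_n n^{-s}` for `Re s` large enough. -/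
def convergentDirichlet : Set (ℂ → ℂ) :=
  {ψ | DifferentiableOn ℂ ψ rightHalfPlane ∧
    ∃ (c : ℕ → ℂ) (σ : ℝ), ∀ s : ℂ, σ < s.re →
      Tendsto (fun N : ℕ => ∑ n ∈ Finset.Icc 1 N, c n * (n : ℂ) ^ (-s)) atTop (𝓝 (ψ s))}

/-- Multiplicative independence: the logarithms are linearly independent over `ℚ`. -/
def MultiplicativelyIndependent (q : ℕ → ℕ) : Prop :=
  LinearIndependent ℚ (fun j : ℕ => Real.log (q j))

/-- Sidon sequences of integers: `∑ |a_j| ≤ C sup_t |∑ a_j e^{i l_j t}|` for all finite sums.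
The supremum is that of a bounded function. -/
def IsSidon (l : ℕ → ℕ) : Prop :=
  ∃ C : ℝ, 0 < C ∧ ∀ (N : ℕ) (a : ℕ → ℂ),
    ∑ j ∈ Finset.range N, ‖a j‖ ≤
      C * ⨆ t : ℝ, ‖∑ j ∈ Finset.range N, a j * Complex.exp (Complex.I * (l j : ℂ) * (t : ℂ))‖

end

/-!
The norms of the images of the monomials `n^{-s}` decide part (a). Expanding
`n^{-φ(s)} = n^{-c₁} (n^{c₀})^{-s} exp(-log n ∑ d_j q_j^{-s})` gives Dirichlet series terms
indexed by the multisets of the `q_j`; by multiplicative independence distinct multisets have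
distinct products, so no cancellation occurs and the norm is exactly `n^{∑ |d_j| - Re c₁}`.
Boundedness keeps it bounded. Compactness forces it to tend to zero, since `Re φ > 0` makes the
images tend to zero pointwise.

For part (b), `∑ d_j w^{l_j}` converges on the whole unit disc, where `w = r^{-s}`, and has real
part bounded below near the unit circle because `Re φ ≥ 0`. Sidon sets have the Fatou–Zygmund
property: such a lower bound controls `∑ |d_j| ρ^{l_j}` uniformly in `ρ < 1`. This is proved on a
finite cyclic group by averaging interpolating measures over random signs against a Riesz product
with coefficients of size `ε`: its first-order terms detect the coefficient sum with weight `ε`,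
while those of order at least two contribute only `ε²` times that sum and are absorbed.
-/

open Filter Topology

noncomputable section

lemma norm_pnat_cpow_neg (n : ℕ+) (s : ℂ) :
    ‖((n : ℕ) : ℂ) ^ (-s)‖ = ((n : ℕ) : ℝ) ^ (-s.re) := by
  rw [Complex.norm_natCast_cpow_of_pos n.pos, Complex.neg_re]

lemma ofReal_mem_rightHalfPlane {x : ℝ} : (x : ℂ) ∈ rightHalfPlane ↔ 0 < x := by
  simp [rightHalfPlane]

lemma isOpen_rightHalfPlane : IsOpen rightHalfPlane :=
  isOpen_lt continuous_const Complex.continuous_re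

namespace WienerDirichlet

lemma summable_norm (f : WienerDirichlet) : Summable fun n => ‖f n‖ := by
  simpa using (lp.memℓp f).summable (by simp)

lemma norm_eq_tsum (f : WienerDirichlet) : ‖f‖ = ∑' n, ‖f n‖ := by
  simpa using lp.norm_eq_tsum_rpow (by simp) f

lemma norm_term_le (f : WienerDirichlet) {s : ℂ} (hs : 0 ≤ s.re) (n : ℕ+) :
    ‖f n * ((n : ℕ) : ℂ) ^ (-s)‖ ≤ ‖f n‖ := by
  rw [norm_mul, norm_pnat_cpow_neg]
  exact mul_le_of_le_one_right (norm_nonneg _)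
    (Real.rpow_le_one_of_one_le_of_nonpos (by exact_mod_cast n.pos) (by linarith))

lemma hasSum_eval (f : WienerDirichlet) {s : ℂ} (hs : 0 ≤ s.re) :
    HasSum (fun n : ℕ+ => f n * ((n : ℕ) : ℂ) ^ (-s)) (f.eval s) :=
  (f.summable_norm.of_norm_bounded (f.norm_term_le hs)).hasSum

lemma norm_eval_le (f : WienerDirichlet) {s : ℂ} (hs : 0 ≤ s.re) : ‖f.eval s‖ ≤ ‖f‖ := by
  rw [f.norm_eq_tsum]
  exact tsum_of_norm_bounded f.summable_norm.hasSum (f.norm_term_le hs)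

lemma eval_sub (f g : WienerDirichlet) {s : ℂ} (hs : 0 ≤ s.re) :
    (f - g).eval s = f.eval s - g.eval s := by
  refine HasSum.unique ?_ ((f.hasSum_eval hs).sub (g.hasSum_eval hs))
  simpa only [lp.coeFn_sub, Pi.sub_apply, sub_mul] using (f - g).hasSum_eval hs

lemma continuous_eval {s : ℂ} (hs : 0 ≤ s.re) :
    Continuous fun f : WienerDirichlet => f.eval s := by
  refine (LipschitzWith.of_dist_le_mul (K := 1) fun f g => ?_).continuous
  simpa [dist_eq_norm, eval_sub f g hs] using (f - g).norm_eval_le hs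

end WienerDirichlet

lemma hasSum_pnat_cpow_neg_iff_LSeriesHasSum {a : ℕ+ → ℂ} {s w : ℂ} :
    HasSum (fun n : ℕ+ => a n * ((n : ℕ) : ℂ) ^ (-s)) w ↔
      LSeriesHasSum (fun n => a n.toPNat') s w := by
  rw [LSeriesHasSum, ← PNat.coe_injective.hasSum_iff fun n hn => ?_]
  · simp [Function.comp_def, LSeries.term_of_ne_zero, Complex.cpow_neg, div_eq_mul_inv]
  · obtain rfl : n = 0 := by
      by_contra h
      exact hn ⟨⟨n, Nat.pos_of_ne_zero h⟩, rfl⟩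
    exact LSeries.term_zero ..

theorem coeff_eq_of_hasSum_pnat_cpow_neg {a b : ℕ+ → ℂ} {F : ℝ → ℂ} {σ : ℝ}
    (ha : ∀ x ≥ σ, HasSum (fun n : ℕ+ => a n * ((n : ℕ) : ℂ) ^ (-(x : ℂ))) (F x))
    (hb : ∀ x ≥ σ, HasSum (fun n : ℕ+ => b n * ((n : ℕ) : ℂ) ^ (-(x : ℂ))) (F x)) :
    a = b := by
  simp only [hasSum_pnat_cpow_neg_iff_LSeriesHasSum] at ha hb
  have abscissa_lt_top {f : ℕ → ℂ} (hf : LSeriesHasSum f σ (F σ)) :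
      LSeries.abscissaOfAbsConv f < ⊤ :=
    hf.LSeriesSummable.abscissaOfAbsConv_le.trans_lt (EReal.coe_lt_top _)
  funext n
  have h : (fun x : ℝ => LSeries (fun n => a n.toPNat') x) =ᶠ[atTop]
      fun x => LSeries (fun n => b n.toPNat') x := by
    filter_upwards [eventually_ge_atTop σ] with x hx
    rw [(ha x hx).LSeries_eq, (hb x hx).LSeries_eq]
  simpa using LSeries.eq_of_LSeries_eventually_eq (abscissa_lt_top (ha σ le_rfl))
    (abscissa_lt_top (hb σ le_rfl)) h n.ne_zero

lemma norm_tsum_of_const {ι : Type*} {u : ι → ℂ} (hu : ∀ i j, u i = u j) :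
    ‖∑' i, u i‖ = ∑' i, ‖u i‖ := by
  obtain _ | ⟨⟨i⟩⟩ := isEmpty_or_nonempty ι
  · simp
  · simp [hu _ i, tsum_const]

namespace WienerDirichlet

lemma eq_zero_of_eval_eq_zero {f : WienerDirichlet} (h : ∀ x : ℝ, 0 < x → f.eval x = 0) :
    f = 0 := by
  refine lp.ext (coeff_eq_of_hasSum_pnat_cpow_neg (F := 0) (σ := 1) (fun x hx => ?_) (by simp))
  have hx0 : 0 < x := by linarith
  simpa [h x hx0] using f.hasSum_eval (s := x) hx0.le

/-- Terms with the same integer `μ i` are equal, so nothing cancels when they are collected. -/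
theorem hasSum_norm_of_const_on_fibers {ι : Type*} {u : ι → ℂ} {μ : ι → ℕ+}
    {f : WienerDirichlet} {σ : ℝ} (hσ : 0 ≤ σ) (hu : ∀ i j, μ i = μ j → u i = u j)
    (hf : ∀ x ≥ σ, HasSum (fun i => u i * ((μ i : ℕ) : ℂ) ^ (-(x : ℂ))) (f.eval x)) :
    HasSum (fun i => ‖u i‖) ‖f‖ := by
  have hcoeff : ⇑f = fun m => ∑' i : μ ⁻¹' {m}, u i := by
    refine coeff_eq_of_hasSum_pnat_cpow_neg (F := fun x => f.eval x) (σ := σ)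
      (fun x hx => f.hasSum_eval (by simpa using hσ.trans hx)) fun x hx => ?_
    refine ((hf x hx).tsum_fiberwise μ).congr_fun fun m => ?_
    rw [← tsum_mul_right]
    exact tsum_congr fun i => by rw [i.2]
  have hnorm : ∀ m, ‖f m‖ = ∑' i : μ ⁻¹' {m}, ‖u i‖ := fun m => by
    rw [hcoeff]
    exact norm_tsum_of_const fun i j => hu i j (i.2.trans j.2.symm)
  have hfiber : ∀ m, Summable fun i : μ ⁻¹' {m} => ‖u i‖ := fun m => by
    have hm : ‖((m : ℕ) : ℂ) ^ (-(σ : ℂ))‖ ≠ 0 := by simp [Complex.cpow_eq_zero_iff]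
    refine (summable_mul_right_iff hm).mp (((hf σ le_rfl).summable.norm.subtype _).congr ?_)
    intro i
    simp [show μ i = m from i.2]
  have hsummable : Summable fun i => ‖u i‖ :=
    (summable_partition (fun i => norm_nonneg (u i)) (s := fun m => μ ⁻¹' {m})
      fun i => ⟨μ i, rfl, fun _ h => h.symm⟩).mpr ⟨hfiber, f.summable_norm.congr hnorm⟩
  rw [f.norm_eq_tsum, funext hnorm, (hsummable.hasSum.tsum_fiberwise μ).tsum_eq]
  exact hsummable.hasSum

end WienerDirichlet

/-- The Dirichlet series `n ^ (-s)`, as an element of the algebra. -/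
def dirichletMonomial (n : ℕ+) : WienerDirichlet := lp.single 1 n (1 : ℂ)

lemma norm_map_dirichletMonomial_le (T : WienerDirichlet →L[ℂ] WienerDirichlet) (n : ℕ+) :
    ‖T (dirichletMonomial n)‖ ≤ ‖T‖ := by
  simpa [dirichletMonomial, lp.norm_single] using T.le_opNorm (dirichletMonomial n)

lemma IsCompositionOperator.eval_map_dirichletMonomial {φ : ℂ → ℂ}
    {T : WienerDirichlet →L[ℂ] WienerDirichlet} (hT : IsCompositionOperator φ T) (n : ℕ+) {s : ℂ}
    (hs : s ∈ rightHalfPlane) : (T (dirichletMonomial n)).eval s = ((n : ℕ) : ℂ) ^ (-(φ s)) := by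
  refine (hT (dirichletMonomial n) s hs).unique ?_
  convert hasSum_ite_eq n (((n : ℕ) : ℂ) ^ (-(φ s))) using 2 with m
  by_cases hm : m = n <;> simp [dirichletMonomial, lp.single_apply, hm]

lemma nonpos_of_forall_rpow_le {a K : ℝ} (h : ∀ n : ℕ+, ((n : ℕ) : ℝ) ^ a ≤ K) : a ≤ 0 := by
  by_contra! ha
  obtain ⟨n, hK, hn⟩ := ((((tendsto_rpow_atTop ha).comp
    tendsto_natCast_atTop_atTop).eventually_gt_atTop K).and (eventually_ge_atTop 1)).exists
  exact (h ⟨n, hn⟩).not_gt hK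

lemma BoundedComposition.re_nonneg {φ : ℂ → ℂ} (hφ : BoundedComposition φ) {s : ℂ}
    (hs : s ∈ rightHalfPlane) : 0 ≤ (φ s).re := by
  obtain ⟨T, hT⟩ := hφ
  refine neg_nonpos.mp (nonpos_of_forall_rpow_le (K := ‖T‖) fun n => ?_)
  rw [← norm_pnat_cpow_neg, ← hT.eval_map_dirichletMonomial n hs]
  exact ((T _).norm_eval_le hs.le).trans (norm_map_dirichletMonomial_le T n)

section ExpTerm

variable {ι 𝕜 : Type*} [RCLike 𝕜] {x : ι → 𝕜}

/-- The terms of the expansion of `exp (∑ j, x j)` into monomials. The monomials are indexed by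
lists, so that each one occurs as many times as its letters have orderings. -/
def expTerm (x : ι → 𝕜) (L : List ι) : 𝕜 := (L.length.factorial : 𝕜)⁻¹ * (L.map x).prod

lemma norm_expTerm (x : ι → 𝕜) (L : List ι) : ‖expTerm x L‖ = expTerm (fun j => ‖x j‖) L := by
  simp [expTerm, List.norm_prod, Function.comp_def]

lemma expTerm_mul_prod (x y : ι → 𝕜) (L : List ι) :
    expTerm x L * (L.map y).prod = expTerm (fun j => x j * y j) L := by
  rw [expTerm, expTerm, List.prod_map_mul, mul_assoc]

lemma expTerm_congr_of_perm (x : ι → 𝕜) {L L' : List ι} (h : L.Perm L') :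
    expTerm x L = expTerm x L' := by
  rw [expTerm, expTerm, h.length_eq, (h.map x).prod_eq]

lemma hasSum_prod_fin {S : 𝕜} (hx : HasSum x S) (k : ℕ) :
    HasSum (fun κ : Fin k → ι => ∏ i, x (κ i)) (S ^ k) := by
  induction k with
  | zero => simp [hasSum_unique]
  | succ k ih =>
    have hmul :=
      (summable_mul_of_summable_norm hx.summable.norm ih.summable.norm).hasSum
    rw [← tsum_mul_tsum_of_summable_norm hx.summable.norm ih.summable.norm, hx.tsum_eq,
      ih.tsum_eq, ← pow_succ'] at hmul
    rw [← (Fin.consEquiv fun _ : Fin (k + 1) => ι).hasSum_iff]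
    refine hmul.congr_fun fun p => ?_
    simp [Fin.consEquiv, Fin.prod_univ_succ]

lemma hasSum_expTerm_ofFn (hx : Summable x) (k : ℕ) :
    HasSum (fun κ : Fin k → ι => expTerm x (List.ofFn κ))
      ((∑' j, x j) ^ k / (k.factorial : 𝕜)) := by
  simpa [expTerm, List.map_ofFn, List.prod_ofFn, div_eq_inv_mul] using
    (hasSum_prod_fin hx.hasSum k).mul_left ((k.factorial : 𝕜)⁻¹)

lemma summable_expTerm (hx : Summable x) : Summable (expTerm x) := by
  refine .of_norm ?_
  have hk := hasSum_expTerm_ofFn hx.norm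
  simp only [← norm_expTerm] at hk
  rw [← List.equivSigmaTuple.symm.summable_iff]
  exact (summable_sigma_of_nonneg fun _ => norm_nonneg _).mpr ⟨fun k => (hk k).summable,
    (Real.summable_pow_div_factorial (∑' j, ‖x j‖)).congr fun k => (hk k).tsum_eq.symm⟩

theorem hasSum_expTerm (hx : Summable x) : HasSum (expTerm x) (NormedSpace.exp (∑' j, x j)) := by
  rw [← List.equivSigmaTuple.symm.hasSum_iff]
  exact HasSum.sigma_of_hasSum (NormedSpace.expSeries_div_hasSum_exp (∑' j, x j))
    (hasSum_expTerm_ofFn hx) (List.equivSigmaTuple.symm.summable_iff.mpr (summable_expTerm hx))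

end ExpTerm

namespace MultiplicativelyIndependent

lemma two_le {q : ℕ → ℕ} (hq : MultiplicativelyIndependent q) (j : ℕ) : 2 ≤ q j := by
  by_contra! h
  refine hq.ne_zero j ?_
  interval_cases q j <;> simp

lemma injective {q : ℕ → ℕ} (hq : MultiplicativelyIndependent q) : Function.Injective q :=
  fun _ _ h => LinearIndependent.injective hq (by simp only [h])

variable {q : ℕ → ℕ+}

theorem multiset_ext (hq : MultiplicativelyIndependent fun j => q j) {s t : Multiset ℕ}
    (h : (s.map q).prod = (t.map q).prod) : s = t := by
  have hlin : LinearIndependent ℕ fun j : ℕ => Real.log (q j) :=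
    LinearIndependent.restrict_scalars (K := ℚ) (fun a b hab => by simpa using hab) hq
  have hlog (s : Multiset ℕ) : Real.log ((s.map q).prod : ℕ+) =
      Finsupp.linearCombination ℕ (fun j : ℕ => Real.log (q j)) (Multiset.toFinsupp s) := by
    induction s using Multiset.induction_on with
    | empty => simp
    | cons a s ih =>
      rw [Multiset.map_cons, Multiset.prod_cons, PNat.mul_coe, Nat.cast_mul,
        Real.log_mul (by simp) (by simp), ih, ← Multiset.singleton_add, map_add, map_add,
        Multiset.toFinsupp_singleton, Finsupp.linearCombination_single, one_smul]
  exact Multiset.toFinsupp.injective (hlin (by rw [← hlog, ← hlog, h]))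

lemma perm_of_prod_eq (hq : MultiplicativelyIndependent fun j => q j) {L L' : List ℕ}
    (h : (L.map q).prod = (L'.map q).prod) : L.Perm L' :=
  Multiset.coe_eq_coe.mp (hq.multiset_ext (by simpa using h))

end MultiplicativelyIndependent

lemma pnat_prod_cpow {ι : Type*} (q : ι → ℕ+) (L : List ι) (z : ℂ) :
    (((L.map q).prod : ℕ+) : ℂ) ^ z = (L.map fun j => ((q j : ℕ) : ℂ) ^ z).prod := by
  induction L with
  | nil => simp
  | cons j L ih => simp [Complex.natCast_mul_natCast_cpow, ← ih]

section SymbolExpansion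

variable {n : ℕ+} {q : ℕ → ℕ+} {c₀ : ℕ} {c₁ : ℂ} {d : ℕ → ℂ}

lemma hasSum_expansion_cpow_neg {s w : ℂ}
    (hd : HasSum (fun j => d j * ((q j : ℕ) : ℂ) ^ (-s)) (w - c₁)) :
    HasSum (fun L : List ℕ => (((n : ℕ) : ℂ) ^ (-c₁) *
        expTerm (fun j => -Complex.log n * d j) L) *
      ((n ^ c₀ * (L.map q).prod : ℕ+) : ℂ) ^ (-s)) (((n : ℕ) : ℂ) ^ (-(c₀ * s + w))) := by
  have hpow : ((n ^ c₀ : ℕ+) : ℂ) ^ (-s) = ((n : ℕ) : ℂ) ^ (c₀ * -s) := by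
    rw [PNat.pow_coe, Nat.cast_pow, Complex.natCast_cpow_natCast_mul]
  have hexp := (hasSum_expTerm (hd.mul_left (-Complex.log n)).summable).mul_left
    (((n : ℕ) : ℂ) ^ (-c₁) * ((n ^ c₀ : ℕ+) : ℂ) ^ (-s))
  have hvalue : ((n : ℕ) : ℂ) ^ (-c₁) * ((n ^ c₀ : ℕ+) : ℂ) ^ (-s) *
      Complex.exp (-Complex.log n * (w - c₁)) = ((n : ℕ) : ℂ) ^ (-(c₀ * s + w)) := by
    simp only [hpow, Complex.cpow_def_of_ne_zero (show ((n : ℕ) : ℂ) ≠ 0 by simp),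
      ← Complex.exp_add]
    ring_nf
  rw [(hd.mul_left _).tsum_eq, ← Complex.exp_eq_exp_ℂ, hvalue] at hexp
  refine hexp.congr_fun fun L => ?_
  simp only [← mul_assoc, ← expTerm_mul_prod, ← pnat_prod_cpow, PNat.mul_coe, Nat.cast_mul,
    Complex.natCast_mul_natCast_cpow]
  ring

variable {ψ : ℂ → ℂ} {f : WienerDirichlet} {σ : ℝ}

lemma MultiplicativelyIndependent.hasSum_norm_expansion
    (hq : MultiplicativelyIndependent fun j => q j)
    (hd : ∀ x ≥ σ, HasSum (fun j => d j * ((q j : ℕ) : ℂ) ^ (-(x : ℂ))) (ψ x - c₁))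
    (hf : ∀ x : ℝ, 0 < x → f.eval x = ((n : ℕ) : ℂ) ^ (-(c₀ * x + ψ x))) :
    HasSum (fun L : List ℕ => ((n : ℕ) : ℝ) ^ (-c₁.re) *
      expTerm (fun j => Real.log n * ‖d j‖) L) ‖f‖ := by
  have h := WienerDirichlet.hasSum_norm_of_const_on_fibers
    (u := fun L : List ℕ => ((n : ℕ) : ℂ) ^ (-c₁) * expTerm (fun j => -Complex.log n * d j) L)
    (μ := fun L => n ^ c₀ * (L.map q).prod) (f := f) (σ := max σ 1) (by simp)
    (fun L L' hL => by rw [expTerm_congr_of_perm _ (hq.perm_of_prod_eq (mul_left_cancel hL))])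
    fun x hx => by
      rw [hf x (by grind)]
      exact hasSum_expansion_cpow_neg (hd x (by grind))
  have hlog : ‖Complex.log n‖ = Real.log n := by
    rw [← Complex.natCast_log, Complex.norm_real, Real.norm_of_nonneg (Real.log_natCast_nonneg _)]
  simpa [norm_expTerm, norm_pnat_cpow_neg, hlog] using h

lemma MultiplicativelyIndependent.summable_norm_coeff (hn : 1 < n)
    (hq : MultiplicativelyIndependent fun j => q j)
    (hd : ∀ x ≥ σ, HasSum (fun j => d j * ((q j : ℕ) : ℂ) ^ (-(x : ℂ))) (ψ x - c₁))
    (hf : ∀ x : ℝ, 0 < x → f.eval x = ((n : ℕ) : ℂ) ^ (-(c₀ * x + ψ x))) :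
    Summable fun j => ‖d j‖ := by
  have h := (hq.hasSum_norm_expansion hd hf).summable.comp_injective
    (i := fun j => [j]) fun _ _ => by simp
  have hlog : Real.log n ≠ 0 :=
    (Real.log_pos (by exact_mod_cast hn)).ne'
  simpa [Function.comp_def, expTerm, summable_mul_left_iff, hlog, Real.rpow_eq_zero_iff_of_nonneg]
    using h

theorem MultiplicativelyIndependent.norm_eq_rpow (hq : MultiplicativelyIndependent fun j => q j)
    (hsum : Summable fun j => ‖d j‖)
    (hd : ∀ x ≥ σ, HasSum (fun j => d j * ((q j : ℕ) : ℂ) ^ (-(x : ℂ))) (ψ x - c₁))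
    (hf : ∀ x : ℝ, 0 < x → f.eval x = ((n : ℕ) : ℂ) ^ (-(c₀ * x + ψ x))) :
    ‖f‖ = ((n : ℕ) : ℝ) ^ (∑' j, ‖d j‖ - c₁.re) := by
  refine (hq.hasSum_norm_expansion hd hf).unique ?_
  have hn : (0 : ℝ) < (n : ℕ) := by simp
  rw [sub_eq_neg_add, Real.rpow_add hn, Real.rpow_def_of_pos hn (∑' j, ‖d j‖), ← tsum_mul_left,
    Real.exp_eq_exp_ℝ]
  exact (hasSum_expTerm (hsum.mul_left _)).mul_left _

end SymbolExpansion

section GeneralDirichletSeries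

variable {lam : ℕ → ℝ} {c₁ : ℂ} {d : ℕ → ℂ} {ψ : ℂ → ℂ}

theorem exists_forall_hasSum_exp_of_tendsto {κ : ℝ} (hlam : ∀ j, 0 ≤ lam j)
    (hκ : Summable fun j => Real.exp (-κ * lam j))
    (h : ∃ σ : ℝ, ∀ s : ℂ, σ < s.re → Tendsto
      (fun N => c₁ + ∑ j ∈ Finset.range N, d j * Complex.exp (-s * lam j)) atTop (𝓝 (ψ s))) :
    ∃ σ : ℝ, ∀ s : ℂ, σ ≤ s.re →
      HasSum (fun j => d j * Complex.exp (-s * lam j)) (ψ s - c₁) := by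
  obtain ⟨σ, h⟩ := h
  have hpartial {s : ℂ} (hs : σ < s.re) : Tendsto
      (fun N => ∑ j ∈ Finset.range N, d j * Complex.exp (-s * lam j)) atTop (𝓝 (ψ s - c₁)) := by
    simpa using (h s hs).sub_const c₁
  have hterm (s : ℂ) (j : ℕ) :
      ‖d j * Complex.exp (-s * lam j)‖ = ‖d j‖ * Real.exp (-s.re * lam j) := by
    simp [Complex.norm_exp]
  obtain ⟨B, hB⟩ : ∃ B, ∀ j, ‖d j‖ * Real.exp (-(|σ| + 1) * lam j) ≤ B := by
    have hs : σ < ((|σ| + 1 : ℝ) : ℂ).re := by grind [Complex.ofReal_re]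
    obtain ⟨B, hB⟩ := (Metric.isBounded_range_of_tendsto _ <|
      ((hpartial hs).comp (tendsto_add_atTop_nat 1)).sub (hpartial hs)).exists_norm_le
    refine ⟨B, fun j => ?_⟩
    simpa [Finset.sum_range_succ, Complex.norm_exp] using hB _ ⟨j, rfl⟩
  refine ⟨|σ| + 1 + |κ|, fun s hs => ?_⟩
  have hsummable : Summable fun j => d j * Complex.exp (-s * lam j) := by
    refine (hκ.mul_left B).of_norm_bounded fun j => ?_
    have hexp : Real.exp (-s.re * lam j) ≤
        Real.exp (-(|σ| + 1) * lam j) * Real.exp (-κ * lam j) := by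
      rw [← Real.exp_add, ← add_mul]
      gcongr
      · exact hlam j
      · grind
    calc ‖d j * Complex.exp (-s * lam j)‖
        ≤ ‖d j‖ * (Real.exp (-(|σ| + 1) * lam j) * Real.exp (-κ * lam j)) := by
          rw [hterm]
          gcongr
      _ ≤ B * Real.exp (-κ * lam j) := by
          rw [← mul_assoc]
          gcongr
          exact hB j
  have hσs : σ < s.re := by grind
  rw [← tendsto_nhds_unique hsummable.hasSum.tendsto_sum_nat (hpartial hσs)]
  exact hsummable.hasSum

end GeneralDirichletSeries

namespace MultiplicativelyIndependent

variable {q : ℕ → ℕ+} {c₀ : ℕ} {c₁ : ℂ} {d : ℕ → ℂ} {φ ψ : ℂ → ℂ}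

lemma exists_forall_hasSum_of_tendsto (hq : MultiplicativelyIndependent fun j => q j)
    (h : ∃ σ : ℝ, ∀ s : ℂ, σ < s.re → Tendsto
      (fun N => c₁ + ∑ j ∈ Finset.range N, d j * ((q j : ℕ) : ℂ) ^ (-s)) atTop (𝓝 (ψ s))) :
    ∃ σ : ℝ, ∀ s : ℂ, σ ≤ s.re →
      HasSum (fun j => d j * ((q j : ℕ) : ℂ) ^ (-s)) (ψ s - c₁) := by
  have hcpow (s : ℂ) (j : ℕ) :
      ((q j : ℕ) : ℂ) ^ (-s) = Complex.exp (-s * (Real.log (q j) : ℝ)) := by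
    rw [Complex.cpow_def_of_ne_zero (by simp), Complex.natCast_log, mul_comm]
  have hsummable : Summable fun j => Real.exp (-2 * Real.log (q j)) := by
    refine ((Real.summable_nat_pow_inv.mpr one_lt_two).comp_injective hq.injective).congr
      fun j => ?_
    rw [neg_mul, Real.exp_neg, mul_comm, Real.exp_mul, Real.exp_log (by simp)]
    simp
  simp only [hcpow] at h ⊢
  exact exists_forall_hasSum_exp_of_tendsto (fun j => Real.log_natCast_nonneg _) hsummable h

theorem norm_map_dirichletMonomial (hq : MultiplicativelyIndependent fun j => q j)
    (hφ : ∀ s ∈ rightHalfPlane, φ s = c₀ * s + ψ s)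
    (h : ∃ σ : ℝ, ∀ s : ℂ, σ < s.re → Tendsto
      (fun N => c₁ + ∑ j ∈ Finset.range N, d j * ((q j : ℕ) : ℂ) ^ (-s)) atTop (𝓝 (ψ s)))
    {T : WienerDirichlet →L[ℂ] WienerDirichlet} (hT : IsCompositionOperator φ T) :
    Summable (fun j => ‖d j‖) ∧ ∀ n : ℕ+,
      ‖T (dirichletMonomial n)‖ = ((n : ℕ) : ℝ) ^ (∑' j, ‖d j‖ - c₁.re) := by
  obtain ⟨σ, hd⟩ := hq.exists_forall_hasSum_of_tendsto h
  have hd' : ∀ x : ℝ, x ≥ σ →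
      HasSum (fun j => d j * ((q j : ℕ) : ℂ) ^ (-(x : ℂ))) (ψ x - c₁) :=
    fun x hx => hd x (by simpa)
  have heval (n : ℕ+) (x : ℝ) (hx : 0 < x) :
      (T (dirichletMonomial n)).eval x = ((n : ℕ) : ℂ) ^ (-(c₀ * x + ψ x)) := by
    have hx' := ofReal_mem_rightHalfPlane.mpr hx
    rw [hT.eval_map_dirichletMonomial n hx', hφ x hx']
  have hsum := hq.summable_norm_coeff (n := 2) (by decide) hd' (heval 2)
  exact ⟨hsum, fun n => hq.norm_eq_rpow hsum hd' (heval n)⟩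

theorem tsum_norm_le_re_of_boundedComposition (hq : MultiplicativelyIndependent fun j => q j)
    (hφ : ∀ s ∈ rightHalfPlane, φ s = c₀ * s + ψ s)
    (h : ∃ σ : ℝ, ∀ s : ℂ, σ < s.re → Tendsto
      (fun N => c₁ + ∑ j ∈ Finset.range N, d j * ((q j : ℕ) : ℂ) ^ (-s)) atTop (𝓝 (ψ s)))
    (hbdd : BoundedComposition φ) : Summable (fun j => ‖d j‖) ∧ ∑' j, ‖d j‖ ≤ c₁.re := by
  obtain ⟨T, hT⟩ := hbdd
  obtain ⟨hsum, hnorm⟩ := hq.norm_map_dirichletMonomial hφ h hT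
  refine ⟨hsum, sub_nonpos.mp (nonpos_of_forall_rpow_le (K := ‖T‖) fun n => ?_)⟩
  exact (hnorm n).symm.trans_le (norm_map_dirichletMonomial_le T n)

end MultiplicativelyIndependent

lemma IsCompositionOperator.tendsto_map_dirichletMonomial {φ : ℂ → ℂ}
    {T : WienerDirichlet →L[ℂ] WienerDirichlet} (hT : IsCompositionOperator φ T)
    (hcompact : IsCompactOperator T) (hφ : ∀ s ∈ rightHalfPlane, 0 < (φ s).re) :
    Tendsto (fun n => T (dirichletMonomial n)) atTop (𝓝 0) := by
  refine (hcompact.isCompact_closure_image_closedBall 1).tendsto_nhds_of_unique_mapClusterPt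
    (.of_forall fun n => subset_closure ⟨_, by simp [dirichletMonomial, lp.norm_single], rfl⟩)
    fun f _ hf => WienerDirichlet.eq_zero_of_eval_eq_zero fun x hx => ?_
  have hx' := ofReal_mem_rightHalfPlane.mpr hx
  have hcluster : MapClusterPt (f.eval x) atTop fun n : ℕ+ => ((n : ℕ) : ℂ) ^ (-(φ x)) := by
    simpa [Function.comp_def, hT.eval_map_dirichletMonomial _ hx'] using
      hf.continuousAt_comp (WienerDirichlet.continuous_eval hx'.le).continuousAt
  have hlim : Tendsto (fun n : ℕ+ => ((n : ℕ) : ℂ) ^ (-(φ x))) atTop (𝓝 0) := by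
    rw [tendsto_zero_iff_norm_tendsto_zero]
    simp only [norm_pnat_cpow_neg]
    exact (tendsto_rpow_neg_atTop (hφ x hx')).comp
      (tendsto_natCast_atTop_atTop.comp tendsto_PNat_val_atTop_atTop)
  exact eq_of_nhds_neBot (hcluster.clusterPt.mono hlim)

/-- By the open mapping theorem. -/
lemma re_pos_of_re_nonneg_of_nonconstant {φ : ℂ → ℂ} (hφ : DifferentiableOn ℂ φ rightHalfPlane)
    (hconst : ¬ ∃ w : ℂ, ∀ s ∈ rightHalfPlane, φ s = w)
    (hnonneg : ∀ s ∈ rightHalfPlane, 0 ≤ (φ s).re) {s : ℂ} (hs : s ∈ rightHalfPlane) :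
    0 < (φ s).re := by
  have hopen : IsOpen (φ '' rightHalfPlane) :=
    ((hφ.analyticOnNhd isOpen_rightHalfPlane).is_constant_or_isOpen
      (convex_halfSpace_re_gt 0).isPreconnected).resolve_left hconst _ subset_rfl
        isOpen_rightHalfPlane
  have hsubset : φ '' rightHalfPlane ⊆ {w | 0 ≤ w.re} := Set.image_subset_iff.mpr hnonneg
  simpa [Complex.interior_setOfPred_le_re] using
    hopen.subset_interior_iff.mpr hsubset (Set.mem_image_of_mem φ hs)

theorem MultiplicativelyIndependent.tsum_norm_lt_re_of_compactComposition {q : ℕ → ℕ+}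
    {c₀ : ℕ} {c₁ : ℂ} {d : ℕ → ℂ} {φ ψ : ℂ → ℂ}
    (hq : MultiplicativelyIndependent fun j => q j) (hψ : DifferentiableOn ℂ ψ rightHalfPlane)
    (hφ : ∀ s ∈ rightHalfPlane, φ s = c₀ * s + ψ s)
    (hconst : ¬ ∃ w : ℂ, ∀ s ∈ rightHalfPlane, φ s = w)
    (h : ∃ σ : ℝ, ∀ s : ℂ, σ < s.re → Tendsto
      (fun N => c₁ + ∑ j ∈ Finset.range N, d j * ((q j : ℕ) : ℂ) ^ (-s)) atTop (𝓝 (ψ s)))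
    (hcompact : CompactComposition φ) :
    Summable (fun j => ‖d j‖) ∧ ∑' j, ‖d j‖ < c₁.re := by
  obtain ⟨T, hT, hTcompact⟩ := hcompact
  obtain ⟨hsum, hnorm⟩ := hq.norm_map_dirichletMonomial hφ h hT
  have hdiff : DifferentiableOn ℂ φ rightHalfPlane :=
    ((differentiableOn_id.const_mul (c₀ : ℂ)).add hψ).congr hφ
  have hlim := (hT.tendsto_map_dirichletMonomial hTcompact fun s hs =>
    re_pos_of_re_nonneg_of_nonconstant hdiff hconst
      (fun _ => BoundedComposition.re_nonneg ⟨T, hT⟩) hs).norm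
  simp only [hnorm, norm_zero] at hlim
  refine ⟨hsum, lt_of_not_ge fun hle => not_le_of_gt one_pos (ge_of_tendsto' hlim fun n => ?_)⟩
  exact Real.one_le_rpow (by exact_mod_cast n.pos) (sub_nonneg.mpr hle)

section Walsh

open scoped BigOperators ComplexConjugate

variable {ι : Type*}

/-- The Walsh function `ω ↦ ∏_{i ∈ A} ω_i` on the cube `{±1}^ι`. -/
def walsh (A : Finset ι) (ω : ι → ℤˣ) : ℝ := ∏ i ∈ A, ((ω i : ℤ) : ℝ)

lemma walsh_mul (A : Finset ι) (ω η : ι → ℤˣ) : walsh A (ω * η) = walsh A ω * walsh A η := by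
  simp [walsh, Finset.prod_mul_distrib]

lemma walsh_singleton_mul_self (i : ι) (ω : ι → ℤˣ) : walsh {i} ω * walsh {i} ω = 1 := by
  rw [← walsh_mul, ← sq]
  simp [walsh]

lemma abs_walsh_singleton (i : ι) (ω : ι → ℤˣ) : |walsh {i} ω| = 1 := by
  rw [← sq_eq_sq₀ (abs_nonneg _) zero_le_one, sq_abs, sq, walsh_singleton_mul_self, one_pow]

variable [Fintype ι]

/-- The Riesz product `∏_i (1 + b_i ω_i)` on the cube `{±1}^ι`. -/
def rieszProduct (b : ι → ℝ) (ω : ι → ℤˣ) : ℝ := ∏ i, (1 + b i * walsh {i} ω)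

lemma rieszProduct_nonneg {b : ι → ℝ} (hb : ∀ i, |b i| ≤ 1) (ω : ι → ℤˣ) :
    0 ≤ rieszProduct b ω :=
  Finset.prod_nonneg fun i _ => by
    have : |b i * walsh {i} ω| ≤ 1 := by rw [abs_mul, abs_walsh_singleton, mul_one]; exact hb i
    linarith [(abs_le.mp this).1]

lemma rieszProduct_eq_sum_walsh (b : ι → ℝ) (ω : ι → ℤˣ) :
    rieszProduct b ω = ∑ A : Finset ι, (∏ i ∈ A, b i) * walsh A ω := by
  simp [rieszProduct, Finset.prod_one_add, walsh, Finset.prod_mul_distrib]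

lemma rieszProduct_one_mul (ω η : ι → ℤˣ) :
    rieszProduct 1 (ω * η) = if ω = η then 2 ^ Fintype.card ι else 0 := by
  split_ifs with h
  · subst h
    simp [rieszProduct, walsh_mul, walsh_singleton_mul_self, one_add_one_eq_two]
  · obtain ⟨i, hi⟩ := Function.ne_iff.mp h
    refine Finset.prod_eq_zero (Finset.mem_univ i) ?_
    have hneg : ω i * η i = -1 :=
      (Int.units_eq_one_or _).resolve_left fun h1 => hi (by
        rw [eq_inv_of_mul_eq_one_left h1, Int.units_inv_eq_self])
    rw [walsh, Finset.prod_singleton, Pi.mul_apply, hneg]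
    simp

lemma sum_eq_sum_two_le_card_add (F : Finset ι → ℂ) :
    ∑ A, F A = ∑ A with 2 ≤ A.card, F A + (F ∅ + ∑ i, F {i}) := by
  classical
  have hsmall : (Finset.univ.filter fun A : Finset ι => ¬ 2 ≤ A.card) =
      insert ∅ (Finset.univ.map ⟨fun i => ({i} : Finset ι), Finset.singleton_injective⟩) := by
    ext A
    simp [Nat.le_one_iff_eq_zero_or_eq_one, Finset.card_eq_one, eq_comm]
  rw [← Finset.sum_filter_add_sum_filter_not Finset.univ (fun A : Finset ι => 2 ≤ A.card),
    hsmall, Finset.sum_insert (by simp), Finset.sum_map]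
  rfl

variable [DecidableEq ι]

/-- The Walsh coefficients of a function on the cube `{±1}^ι`. -/
def walshCoeff (u : (ι → ℤˣ) → ℂ) (A : Finset ι) : ℂ := 𝔼 ω, (walsh A ω : ℂ) * u ω

/-- The bilinear form on functions on the cube whose kernel is a Riesz product. It is diagonal
in the Walsh basis. -/
def rieszForm (b : ι → ℝ) (u v : (ι → ℤˣ) → ℂ) : ℂ :=
  𝔼 ω, 𝔼 η, (rieszProduct b (ω * η) : ℂ) * (u ω * v η)

lemma walshCoeff_conj (u : (ι → ℤˣ) → ℂ) (A : Finset ι) :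
    walshCoeff (fun ω => conj (u ω)) A = conj (walshCoeff u A) := by
  simp only [walshCoeff, map_expect, map_mul, Complex.conj_ofReal]

lemma walshCoeff_add (u v : (ι → ℤˣ) → ℂ) (A : Finset ι) :
    walshCoeff (fun ω => u ω + v ω) A = walshCoeff u A + walshCoeff v A := by
  simp only [walshCoeff, mul_add, Finset.expect_add_distrib]

lemma walshCoeff_const_mul (c : ℂ) (u : (ι → ℤˣ) → ℂ) (A : Finset ι) :
    walshCoeff (fun ω => c * u ω) A = c * walshCoeff u A := by
  simp only [walshCoeff, Finset.mul_expect, mul_left_comm]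

lemma walshCoeff_singleton_of_even {u : (ι → ℤˣ) → ℂ} (hu : ∀ ω, u (-ω) = u ω) (i : ι) :
    walshCoeff u {i} = 0 := by
  refine self_eq_neg.mp ?_
  rw [walshCoeff, ← Finset.expect_neg_distrib]
  exact Fintype.expect_equiv (Equiv.neg _) _ _ fun ω => by simp [walsh, hu]

lemma walshCoeff_walsh_singleton (i : ι) : walshCoeff (fun ω => (walsh {i} ω : ℂ)) {i} = 1 := by
  simp only [walshCoeff, ← Complex.ofReal_mul, walsh_singleton_mul_self, Complex.ofReal_one,
    Fintype.expect_one]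

lemma rieszForm_eq_sum (b : ι → ℝ) (u v : (ι → ℤˣ) → ℂ) :
    rieszForm b u v =
      ∑ A : Finset ι, ((∏ i ∈ A, b i : ℝ) : ℂ) * (walshCoeff u A * walshCoeff v A) := by
  simp only [rieszForm, walshCoeff, rieszProduct_eq_sum_walsh, walsh_mul,
    Finset.expect_mul_expect, Complex.ofReal_sum, Complex.ofReal_mul, Finset.sum_mul]
  simp only [Finset.mul_expect, ← Finset.expect_sum_comm]
  refine Finset.expect_congr rfl fun ω _ => Finset.expect_congr rfl fun η _ =>
    Finset.sum_congr rfl fun A _ => ?_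
  ring

lemma sum_norm_sq_walshCoeff (u : (ι → ℤˣ) → ℂ) :
    ∑ A : Finset ι, ‖walshCoeff u A‖ ^ 2 = 𝔼 ω, ‖u ω‖ ^ 2 := by
  have h := rieszForm_eq_sum 1 u fun ω => conj (u ω)
  have hdelta (ω : ι → ℤˣ) :
      (𝔼 η, (rieszProduct 1 (ω * η) : ℂ) * (u ω * conj (u η))) = ((‖u ω‖ ^ 2 : ℝ) : ℂ) := by
    rw [Fintype.expect_eq_sum_div_card, Finset.sum_eq_single ω
      (fun η _ hη => by rw [rieszProduct_one_mul, if_neg hη.symm]; simp) (by simp),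
      rieszProduct_one_mul, if_pos rfl, Complex.mul_conj']
    simp
  rw [rieszForm, Finset.expect_congr rfl fun ω _ => hdelta ω] at h
  simp only [walshCoeff_conj, Pi.one_apply, Finset.prod_const_one, Complex.ofReal_one, one_mul,
    Complex.mul_conj'] at h
  exact_mod_cast h.symm

lemma sum_norm_sq_walshCoeff_le {u : (ι → ℤˣ) → ℂ} {K : ℝ} (hu : ∀ ω, ‖u ω‖ ≤ K) :
    ∑ A : Finset ι, ‖walshCoeff u A‖ ^ 2 ≤ K ^ 2 := by
  rw [sum_norm_sq_walshCoeff]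
  exact Finset.expect_le Finset.univ_nonempty fun ω _ => by gcongr; exact hu ω

lemma norm_prod_mul_walshCoeff_sq_le {b : ι → ℝ} {ε : ℝ} (hb : ∀ i, |b i| ≤ ε)
    (u : (ι → ℤˣ) → ℂ) (A : Finset ι) :
    ‖((∏ i ∈ A, b i : ℝ) : ℂ) * (walshCoeff u A * walshCoeff u A)‖ ≤
      ε ^ A.card * ‖walshCoeff u A‖ ^ 2 := by
  rw [norm_mul, norm_mul, ← sq, Complex.norm_real, Real.norm_eq_abs, Finset.abs_prod,
    ← Finset.prod_const]
  gcongr with i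
  exact hb i

lemma norm_rieszForm_self_le {b : ι → ℝ} (hb : ∀ i, |b i| ≤ 1) {u : (ι → ℤˣ) → ℂ} {K : ℝ}
    (hu : ∀ ω, ‖u ω‖ ≤ K) : ‖rieszForm b u u‖ ≤ K ^ 2 := by
  rw [rieszForm_eq_sum]
  refine (norm_sum_le_of_le _ fun A _ => ?_).trans (sum_norm_sq_walshCoeff_le hu)
  simpa using norm_prod_mul_walshCoeff_sq_le hb u A

lemma norm_rieszForm_self_sub_le {b : ι → ℝ} {ε : ℝ} (hε0 : 0 ≤ ε) (hε1 : ε ≤ 1)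
    (hb : ∀ i, |b i| ≤ ε) {u : (ι → ℤˣ) → ℂ} {K : ℝ} (hu : ∀ ω, ‖u ω‖ ≤ K) :
    ‖rieszForm b u u - walshCoeff u ∅ ^ 2 - ∑ i, b i * walshCoeff u {i} ^ 2‖ ≤
      ε ^ 2 * K ^ 2 := by
  rw [rieszForm_eq_sum, sum_eq_sum_two_le_card_add]
  simp only [Finset.prod_empty, Finset.prod_singleton, Complex.ofReal_one, one_mul, ← sq,
    sub_sub, add_sub_cancel_right]
  calc _ ≤ ∑ A : Finset ι with 2 ≤ A.card, ε ^ 2 * ‖walshCoeff u A‖ ^ 2 := by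
        refine norm_sum_le_of_le _ fun A hA => ?_
        rw [sq (walshCoeff u A)]
        refine (norm_prod_mul_walshCoeff_sq_le hb u A).trans ?_
        gcongr ?_ * _
        exact pow_le_pow_of_le_one hε0 hε1 (Finset.mem_filter.mp hA).2
    _ ≤ ∑ A : Finset ι, ε ^ 2 * ‖walshCoeff u A‖ ^ 2 :=
        Finset.sum_le_univ_sum_of_nonneg fun A => by positivity
    _ ≤ ε ^ 2 * K ^ 2 := by
        rw [← Finset.mul_sum]
        gcongr
        exact sum_norm_sq_walshCoeff_le hu

end Walsh

section FatouZygmund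

open scoped BigOperators ComplexConjugate

section Interpolation

variable {ι 𝕜 E : Type*} [Fintype ι] [RCLike 𝕜] [NormedAddCommGroup E] [NormedSpace 𝕜 E]

lemma exists_dual_norm_le_and_apply_eq {v : ι → E} {C : ℝ} (hC0 : 0 ≤ C)
    (hC : ∀ a : ι → 𝕜, ∑ j, ‖a j‖ ≤ C * ‖∑ j, a j • v j‖) {w : ι → 𝕜} (hw : ∀ j, ‖w j‖ ≤ 1) :
    ∃ g : StrongDual 𝕜 E, ‖g‖ ≤ C ∧ ∀ j, g (v j) = w j := by
  classical
  let A : (ι → 𝕜) →ₗ[𝕜] E := Fintype.linearCombination 𝕜 v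
  have hA : Function.Injective A := by
    refine (injective_iff_map_eq_zero A).mpr fun a ha => funext fun j => norm_le_zero_iff.mp ?_
    calc ‖a j‖ ≤ ∑ j, ‖a j‖ :=
          Finset.single_le_sum (fun j _ => norm_nonneg (a j)) (Finset.mem_univ j)
      _ ≤ C * ‖A a‖ := hC a
      _ = 0 := by rw [ha, norm_zero, mul_zero]
  let e := LinearEquiv.ofInjective A hA
  let f : StrongDual 𝕜 (LinearMap.range A) :=
    LinearMap.mkContinuous (Fintype.linearCombination 𝕜 w ∘ₗ e.symm.toLinearMap) C fun z => by
      obtain ⟨a, rfl⟩ := e.surjective z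
      rw [LinearMap.comp_apply, LinearEquiv.coe_coe, LinearEquiv.symm_apply_apply]
      refine (norm_sum_le_of_le _ fun j _ => ?_).trans (hC a)
      rw [norm_smul]
      exact mul_le_of_le_one_right (norm_nonneg _) (hw j)
  obtain ⟨g, hgf, hg_norm⟩ := exists_extension_norm_eq _ f
  refine ⟨g, hg_norm.trans_le (LinearMap.mkContinuous_norm_le _ hC0 _), fun j => ?_⟩
  have h : g (A (Pi.single j 1)) = Fintype.linearCombination 𝕜 w (Pi.single j 1) := by
    have hext := hgf (e (Pi.single j 1))
    rwa [LinearMap.mkContinuous_apply, LinearMap.comp_apply, LinearEquiv.coe_coe,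
      LinearEquiv.symm_apply_apply] at hext
  simpa [A] using h

lemma sum_norm_apply_single_le [DecidableEq ι] (g : StrongDual 𝕜 (ι → 𝕜)) :
    ∑ y, ‖g (Pi.single y 1)‖ ≤ ‖g‖ := by
  let v : ι → 𝕜 := fun y => conj (g (Pi.single y 1)) / ‖g (Pi.single y 1)‖
  have hv : ‖v‖ ≤ 1 := (pi_norm_le_iff_of_nonneg zero_le_one).mpr fun y => by
    simpa [v] using div_self_le_one ‖g (Pi.single y 1)‖
  have hgv : g v = ((∑ y, ‖g (Pi.single y 1)‖ : ℝ) : 𝕜) := by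
    rw [pi_eq_sum_univ' v, map_sum, RCLike.ofReal_sum]
    refine Finset.sum_congr rfl fun y _ => ?_
    rw [map_smul, smul_eq_mul, div_mul_eq_mul_div, RCLike.conj_mul, sq, mul_self_div_self]
  calc ∑ y, ‖g (Pi.single y 1)‖ = ‖g v‖ := by
        rw [hgv, RCLike.norm_of_nonneg (Finset.sum_nonneg fun y _ => norm_nonneg _)]
    _ ≤ ‖g‖ := g.unit_le_opNorm v hv

end Interpolation

section Density

variable {Ω Y : Type*} {g : Ω → Y → ℂ} {θ : ℂ} {C : ℝ}

/-- The density `|g_ω| + Re (θ g_ω)`, which for `|θ| = 1` is nonnegative and has at most twice the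
mass of `|g_ω|`. -/
def density (g : Ω → Y → ℂ) (θ : ℂ) (ω : Ω) (y : Y) : ℝ := ‖g ω y‖ + (θ * g ω y).re

lemma abs_re_mul_le (hθ : ‖θ‖ = 1) (z : ℂ) : |(θ * z).re| ≤ ‖z‖ := by
  simpa only [norm_mul, hθ, one_mul] using Complex.abs_re_le_norm (θ * z)

lemma density_nonneg (hθ : ‖θ‖ = 1) (ω : Ω) (y : Y) : 0 ≤ density g θ ω y :=
  neg_le_iff_add_nonneg'.mp (neg_le_of_abs_le (abs_re_mul_le hθ (g ω y)))

lemma sum_density_le [Fintype Y] (hθ : ‖θ‖ = 1) (hg : ∀ ω, ∑ y, ‖g ω y‖ ≤ C) (ω : Ω) :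
    ∑ y, density g θ ω y ≤ 2 * C := by
  refine le_trans ?_ (mul_le_mul_of_nonneg_left (hg ω) zero_le_two)
  rw [Finset.mul_sum]
  refine Finset.sum_le_sum fun y _ => ?_
  rw [two_mul]
  exact add_le_add_right (le_of_abs_le (abs_re_mul_le hθ (g ω y))) _

end Density

variable {ι κ Ω G : Type*} [Fintype G]

/-- The Fourier transforms `ω ↦ ∑_y P_ω(y) χ(y)` of a family of weights `P_ω` on a finite group. -/
def charTransform [AddMonoid G] (P : Ω → G → ℝ) (χ : AddChar G ℂ) (ω : Ω) : ℂ :=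
  ∑ y, P ω y * χ y

variable [AddCommGroup G]

lemma norm_charTransform_le {P : Ω → G → ℝ} {K : ℝ} (hP : ∀ ω y, 0 ≤ P ω y)
    (hK : ∀ ω, ∑ y, P ω y ≤ K) (χ : AddChar G ℂ) (ω : Ω) : ‖charTransform P χ ω‖ ≤ K :=
  (norm_sum_le_of_le _ fun y _ => by
    rw [norm_mul, AddChar.norm_apply, mul_one, Complex.norm_real,
      Real.norm_of_nonneg (hP ω y)]).trans (hK ω)

lemma sum_mul_charTransform_mul [Fintype κ] (χ : κ → AddChar G ℂ) (a : κ → ℂ) (P : Ω → G → ℝ)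
    (ω η : Ω) (x : G) :
    ∑ k, a k * χ k x * (charTransform P (χ k) ω * charTransform P (χ k) η) =
      ∑ y, ∑ y', ((P ω y * P η y' : ℝ) : ℂ) * ∑ k, a k * χ k (x + y + y') := by
  simp only [charTransform, Finset.sum_mul_sum]
  simp only [Finset.mul_sum]
  rw [Finset.sum_comm]
  refine Finset.sum_congr rfl fun y _ => ?_
  rw [Finset.sum_comm]
  refine Finset.sum_congr rfl fun y' _ => Finset.sum_congr rfl fun k _ => ?_
  rw [AddChar.map_add_eq_mul, AddChar.map_add_eq_mul]
  push_cast
  ring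

lemma expect_mul_conj [DecidableEq (AddChar G ℂ)] (χ ψ : AddChar G ℂ) :
    𝔼 x, χ x * conj (ψ x) = if χ = ψ then 1 else 0 := by
  have h := AddChar.expect_eq_ite (χ - ψ)
  simpa only [AddChar.sub_apply, AddChar.map_neg_eq_conj, sub_eq_zero] using h

variable [Fintype ι]

/-- Only the `χ_i`-coefficient of `2 Re f = f + conj f` survives in the pairing with `χ_i`,
since `f` and `conj f` have disjoint spectra. -/
lemma norm_coeff_le_two_mul_expect_abs_re {χ : ι → AddChar G ℂ} (hχ_inj : Function.Injective χ)
    (hχ : ∀ i j, χ i + χ j ≠ 0) (α : ι → ℂ) (i : ι) :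
    ‖α i‖ ≤ 2 * 𝔼 x, |(∑ j, α j * χ j x).re| := by
  classical
  have hanalytic : 𝔼 x, (∑ j, α j * χ j x) * conj (χ i x) = α i := by
    simp_rw [Finset.sum_mul, mul_assoc, Finset.expect_sum_comm, ← Finset.mul_expect,
      expect_mul_conj, hχ_inj.eq_iff]
    simp
  have hantianalytic : 𝔼 x, conj (∑ j, α j * χ j x) * conj (χ i x) = 0 := by
    simp_rw [← map_mul, ← map_expect, Finset.sum_mul, mul_assoc, Finset.expect_sum_comm,
      ← Finset.mul_expect, ← AddChar.add_apply, AddChar.expect_eq_ite, if_neg (hχ _ _)]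
    simp
  calc ‖α i‖ = ‖𝔼 x, (2 * (∑ j, α j * χ j x).re : ℝ) * conj (χ i x)‖ := by
        rw [← add_zero (α i), ← hantianalytic, ← hanalytic, ← Finset.expect_add_distrib]
        simp only [← add_mul, Complex.add_conj]
    _ ≤ 𝔼 x, ‖((2 * (∑ j, α j * χ j x).re : ℝ) : ℂ) * conj (χ i x)‖ :=
        RCLike.norm_expect_le (K := ℂ)
    _ = 2 * 𝔼 x, |(∑ j, α j * χ j x).re| := by
        simp only [norm_mul, RCLike.norm_conj, AddChar.norm_apply, mul_one, Complex.norm_real,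
          Real.norm_eq_abs, abs_two, Finset.mul_expect]

section Positivity

variable {P : (ι → ℤˣ) → G → ℝ}

lemma re_sum_mul_rieszForm_nonneg [DecidableEq ι] [Fintype κ] {χ : κ → AddChar G ℂ} {a : κ → ℂ}
    (ha : ∀ y, 0 ≤ (∑ k, a k * χ k y).re) (hP : ∀ ω y, 0 ≤ P ω y) {b : ι → ℝ}
    (hb : ∀ i, |b i| ≤ 1) (x : G) :
    0 ≤ (∑ k, a k * χ k x * rieszForm b (charTransform P (χ k))
      (charTransform P (χ k))).re := by
  have hkernel : ∑ k, a k * χ k x * rieszForm b (charTransform P (χ k))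
      (charTransform P (χ k)) =
      𝔼 ω, 𝔼 η, (rieszProduct b (ω * η) : ℂ) *
        ∑ y, ∑ y', ((P ω y * P η y' : ℝ) : ℂ) * ∑ k, a k * χ k (x + y + y') := by
    simp only [rieszForm, ← sum_mul_charTransform_mul]
    simp only [Finset.mul_sum, Finset.expect_sum_comm, Finset.mul_expect, mul_left_comm]
  simp only [hkernel, Complex.re_expect, Complex.re_sum, Complex.re_ofReal_mul]
  refine Finset.expect_nonneg fun ω _ => Finset.expect_nonneg fun η _ =>
    mul_nonneg (rieszProduct_nonneg hb _) (Finset.sum_nonneg fun y _ =>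
      Finset.sum_nonneg fun y' _ => mul_nonneg (mul_nonneg (hP ω y) (hP η y')) ?_)
  simpa only [Complex.re_sum] using ha (x + y + y')

variable [DecidableEq ι] {χ : ι → AddChar G ℂ} {a : ι → ℂ} {B K ε : ℝ}

lemma neg_le_re_sum_mul_rieszForm (hB0 : 0 ≤ B) (ha : ∀ y, -B ≤ (∑ j, a j * χ j y).re)
    (hP : ∀ ω y, 0 ≤ P ω y) (hK : ∀ ω, ∑ y, P ω y ≤ K) {b : ι → ℝ} (hb : ∀ i, |b i| ≤ 1) (x : G) :
    -(K ^ 2 * B) ≤ (∑ j, a j * χ j x * rieszForm b (charTransform P (χ j))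
      (charTransform P (χ j))).re := by
  have h := re_sum_mul_rieszForm_nonneg (χ := fun k : Option ι => k.elim 0 χ)
    (a := fun k => k.elim (B : ℂ) a)
    (fun y => by
      simp only [Fintype.sum_option, Option.elim_none, Option.elim_some, AddChar.zero_apply,
        mul_one, Complex.add_re, Complex.ofReal_re]
      linarith [ha y]) hP hb x
  simp only [Fintype.sum_option, Option.elim_none, Option.elim_some, AddChar.zero_apply,
    mul_one, Complex.add_re, Complex.re_ofReal_mul] at h
  have hconst := (Complex.re_le_norm _).trans <| norm_rieszForm_self_le hb
    (norm_charTransform_le hP hK 0)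
  linarith [mul_le_mul_of_nonneg_left hconst hB0]

/-- Take `b_i = -ε sign c_i(x)`, where `c_i(x)` is the real part in the sum on the left. -/
lemma mul_sum_abs_re_le (hB0 : 0 ≤ B) (ha : ∀ y, -B ≤ (∑ j, a j * χ j y).re)
    (hP : ∀ ω y, 0 ≤ P ω y) (hK : ∀ ω, ∑ y, P ω y ≤ K) (hε0 : 0 ≤ ε) (hε1 : ε ≤ 1) (x : G) :
    ε * ∑ i, |(∑ j, a j * walshCoeff (charTransform P (χ j)) {i} ^ 2 * χ j x).re| ≤
      K ^ 2 * B +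
        (∑ j, a j * walshCoeff (charTransform P (χ j)) ∅ ^ 2 * χ j x).re +
        ε ^ 2 * K ^ 2 * ∑ j, ‖a j‖ := by
  let u := fun j => charTransform P (χ j)
  let c := fun i => (∑ j, a j * walshCoeff (u j) {i} ^ 2 * χ j x).re
  let b := fun i => -ε * SignType.sign (c i)
  have hu : ∀ j ω, ‖u j ω‖ ≤ K := fun j => norm_charTransform_le hP hK (χ j)
  have hb : ∀ i, |b i| ≤ ε := fun i => by
    rw [abs_mul, abs_neg, abs_of_nonneg hε0]
    refine mul_le_of_le_one_right hε0 ?_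
    rcases SignType.sign (c i) with _ | _ | _ <;> simp
  have hlower : -(K ^ 2 * B) ≤ (∑ j, a j * χ j x * rieszForm b (u j) (u j)).re :=
    neg_le_re_sum_mul_rieszForm hB0 ha hP hK (fun i => (hb i).trans hε1) x
  have herror : (∑ j, a j * χ j x * (rieszForm b (u j) (u j) - walshCoeff (u j) ∅ ^ 2 -
      ∑ i, b i * walshCoeff (u j) {i} ^ 2)).re ≤ ε ^ 2 * K ^ 2 * ∑ j, ‖a j‖ := by
    refine (Complex.re_le_norm _).trans ?_
    rw [Finset.mul_sum]
    refine norm_sum_le_of_le _ fun j _ => ?_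
    rw [norm_mul, norm_mul, AddChar.norm_apply, mul_one, mul_comm]
    gcongr
    exact norm_rieszForm_self_sub_le hε0 hε1 hb (hu j)
  have hlinear : (∑ j, a j * χ j x * ∑ i, b i * walshCoeff (u j) {i} ^ 2).re =
      -(ε * ∑ i, |c i|) := by
    have hcomm : ∑ j, a j * χ j x * ∑ i, b i * walshCoeff (u j) {i} ^ 2 =
        ∑ i, (b i : ℂ) * ∑ j, a j * walshCoeff (u j) {i} ^ 2 * χ j x := by
      simp only [Finset.mul_sum]
      rw [Finset.sum_comm]
      exact Finset.sum_congr rfl fun i _ => Finset.sum_congr rfl fun j _ => by ring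
    rw [hcomm, Complex.re_sum, Finset.mul_sum, ← Finset.sum_neg_distrib]
    refine Finset.sum_congr rfl fun i _ => ?_
    rw [Complex.re_ofReal_mul, mul_assoc, sign_mul_self, neg_mul]
  simp only [mul_sub, Finset.sum_sub_distrib, Complex.sub_re, hlinear,
    mul_right_comm _ _ (walshCoeff _ ∅ ^ 2)] at herror
  change ε * ∑ i, |c i| ≤ K ^ 2 * B + (∑ j, a j * walshCoeff (u j) ∅ ^ 2 * χ j x).re + _
  linarith

lemma half_mul_sum_norm_mul_norm_sq_le (hχ_inj : Function.Injective χ)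
    (hχ : ∀ i j, χ i + χ j ≠ 0) (hB0 : 0 ≤ B) (ha : ∀ y, -B ≤ (∑ j, a j * χ j y).re)
    (hP : ∀ ω y, 0 ≤ P ω y) (hK : ∀ ω, ∑ y, P ω y ≤ K) (hε0 : 0 ≤ ε) (hε1 : ε ≤ 1) :
    ε / 2 * ∑ i, ‖a i‖ * ‖walshCoeff (charTransform P (χ i)) {i}‖ ^ 2 ≤
      K ^ 2 * B + ε ^ 2 * K ^ 2 * ∑ j, ‖a j‖ := by
  have havg := Finset.expect_le_expect fun x (_ : x ∈ Finset.univ) =>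
    mul_sum_abs_re_le hB0 ha hP hK hε0 hε1 x
  have hmean : 𝔼 x, (∑ j, a j * walshCoeff (charTransform P (χ j)) ∅ ^ 2 * χ j x).re = 0 := by
    have hχ_zero : ∀ j, χ j ≠ 0 := fun j h => hχ j j (by rw [h, add_zero])
    simp_rw [← Complex.re_expect, Finset.expect_sum_comm, ← Finset.mul_expect,
      AddChar.expect_eq_ite, if_neg (hχ_zero _)]
    simp
  simp only [Finset.expect_add_distrib, Fintype.expect_const, ← Finset.mul_expect, hmean,
    add_zero, Finset.expect_sum_comm] at havg
  refine le_trans ?_ havg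
  rw [div_mul_eq_mul_div, mul_div_assoc, Finset.sum_div]
  gcongr with i
  have hcoeff := norm_coeff_le_two_mul_expect_abs_re hχ_inj hχ
    (fun j => a j * walshCoeff (charTransform P (χ j)) {i} ^ 2) i
  rw [norm_mul, norm_pow] at hcoeff
  linarith

end Positivity

section OddInterpolation

variable {g : (ι → ℤˣ) → G → ℂ} {χ : ι → AddChar G ℂ}

lemma exists_odd_interpolation {C : ℝ} (hC0 : 0 ≤ C)
    (hC : ∀ a : ι → ℂ, ∑ j, ‖a j‖ ≤ C * ‖∑ j, a j • (χ j : G → ℂ)‖) :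
    ∃ g : (ι → ℤˣ) → G → ℂ, (∀ ω y, g (-ω) y = -g ω y) ∧ (∀ ω, ∑ y, ‖g ω y‖ ≤ C) ∧
      ∀ ω j, ∑ y, g ω y * χ j y = walsh {j} ω := by
  classical
  have hdual (ω : ι → ℤˣ) := exists_dual_norm_le_and_apply_eq hC0 hC
    (w := fun j => (walsh {j} ω : ℂ)) fun j => by
      rw [Complex.norm_real, Real.norm_eq_abs, abs_walsh_singleton]
  choose L hL_norm hL using hdual
  let L' : (ι → ℤˣ) → StrongDual ℂ (G → ℂ) := fun ω => (1 / 2 : ℂ) • (L ω - L (-ω))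
  refine ⟨fun ω y => L' ω (Pi.single y 1), fun ω y => ?_, fun ω => ?_, fun ω j => ?_⟩
  · have hodd : L' (-ω) = -L' ω := by
      change _ • (L (-ω) - L (- -ω)) = -(_ • (L ω - L (-ω)))
      rw [neg_neg, ← neg_sub (L ω), smul_neg]
    change L' (-ω) (Pi.single y 1) = -L' ω (Pi.single y 1)
    rw [hodd, neg_apply]
  · refine (sum_norm_apply_single_le (L' ω)).trans ?_
    calc ‖L' ω‖ ≤ ‖(1 / 2 : ℂ)‖ * (‖L ω‖ + ‖L (-ω)‖) := by
          rw [norm_smul]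
          gcongr
          exact norm_sub_le _ _
      _ ≤ ‖(1 / 2 : ℂ)‖ * (C + C) := by gcongr <;> exact hL_norm _
      _ = C := by rw [norm_div, norm_one, Complex.norm_ofNat]; ring
  · have happly : L' ω (χ j) = walsh {j} ω := by
      have hneg : walsh {j} (-ω) = -walsh {j} ω := by simp [walsh]
      simp only [L', smul_apply, sub_apply, hL, hneg,
        smul_eq_mul, Complex.ofReal_neg]
      ring
    calc ∑ y, L' ω (Pi.single y 1) * χ j y = L' ω (∑ y, χ j y • Pi.single y 1) := by
          simp only [map_sum, map_smul, smul_eq_mul, mul_comm]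
      _ = walsh {j} ω := by rw [← pi_eq_sum_univ' (χ j : G → ℂ), happly]

variable [DecidableEq ι]

lemma walshCoeff_charTransform_density (hg_odd : ∀ ω y, g (-ω) y = -g ω y)
    (hg : ∀ ω j, ∑ y, g ω y * χ j y = walsh {j} ω) (θ : ℂ) (i : ι) :
    walshCoeff (charTransform (density g θ) (χ i)) {i} =
      (θ + conj θ * walshCoeff (fun ω => ∑ y, conj (g ω y) * χ i y) {i}) / 2 := by
  have hsplit : charTransform (density g θ) (χ i) = fun ω => (∑ y, (‖g ω y‖ : ℂ) * χ i y) +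
      (θ / 2 * walsh {i} ω + conj θ / 2 * ∑ y, conj (g ω y) * χ i y) := by
    ext ω
    simp only [charTransform, density, ← hg, Finset.mul_sum, ← Finset.sum_add_distrib]
    refine Finset.sum_congr rfl fun y _ => ?_
    rw [Complex.ofReal_add, Complex.re_eq_add_conj, map_mul]
    ring
  rw [hsplit, walshCoeff_add, walshCoeff_add, walshCoeff_const_mul, walshCoeff_const_mul,
    walshCoeff_walsh_singleton,
    walshCoeff_singleton_of_even fun ω => by simp only [hg_odd, norm_neg]]
  ring

lemma half_le_norm_sq_walshCoeff_add (hg_odd : ∀ ω y, g (-ω) y = -g ω y)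
    (hg : ∀ ω j, ∑ y, g ω y * χ j y = walsh {j} ω) (i : ι) :
    1 / 2 ≤ ‖walshCoeff (charTransform (density g 1) (χ i)) {i}‖ ^ 2 +
      ‖walshCoeff (charTransform (density g Complex.I) (χ i)) {i}‖ ^ 2 := by
  rw [walshCoeff_charTransform_density hg_odd hg, walshCoeff_charTransform_density hg_odd hg]
  set ν := walshCoeff (fun ω => ∑ y, conj (g ω y) * χ i y) {i}
  have hparallelogram := parallelogram_law_with_norm ℝ 1 ν
  have hfactor : Complex.I + conj Complex.I * ν = Complex.I * (1 - ν) := by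
    rw [Complex.conj_I]
    ring
  rw [hfactor, map_one, one_mul, norm_div, norm_div, norm_mul, Complex.norm_I, one_mul,
    Complex.norm_ofNat]
  rw [norm_one] at hparallelogram
  linarith [sq_nonneg ‖ν‖]

end OddInterpolation

/-- The Fatou–Zygmund property: the two rotations `θ = 1, I` of an odd interpolating measure cannot
both have small `i`-th Walsh coefficients, and the choice `ε = 1 / (64 C ^ 2)` lets the left-hand
side of `half_mul_sum_norm_mul_norm_sq_le` absorb its quadratic error term. -/
theorem sum_norm_le_of_neg_le_re {χ : ι → AddChar G ℂ} {a : ι → ℂ} {B C : ℝ}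
    (hχ_inj : Function.Injective χ) (hχ : ∀ i j, χ i + χ j ≠ 0) (hC1 : 1 ≤ C)
    (hC : ∀ a : ι → ℂ, ∑ j, ‖a j‖ ≤ C * ‖∑ j, a j • (χ j : G → ℂ)‖) (hB0 : 0 ≤ B)
    (ha : ∀ y, -B ≤ (∑ j, a j * χ j y).re) : ∑ j, ‖a j‖ ≤ 4096 * C ^ 4 * B := by
  classical
  obtain ⟨g, hg_odd, hgC, hg⟩ := exists_odd_interpolation (zero_le_one.trans hC1) hC
  let S := ∑ j, ‖a j‖
  let ε := 1 / (64 * C ^ 2)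
  let D (θ : ℂ) (i : ι) : ℝ := ‖walshCoeff (charTransform (density g θ) (χ i)) {i}‖ ^ 2
  have hε1 : ε ≤ 1 := (div_le_one (by positivity)).mpr (by nlinarith)
  have hrotation {θ : ℂ} (hθ : ‖θ‖ = 1) :
      ε / 2 * ∑ i, ‖a i‖ * D θ i ≤ (2 * C) ^ 2 * B + ε ^ 2 * (2 * C) ^ 2 * S :=
    half_mul_sum_norm_mul_norm_sq_le hχ_inj hχ hB0 ha (density_nonneg hθ)
      (sum_density_le hθ hgC) (by positivity) hε1
  have hlower : S / 2 ≤ ∑ i, ‖a i‖ * D 1 i + ∑ i, ‖a i‖ * D Complex.I i := by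
    rw [← Finset.sum_add_distrib, Finset.sum_div]
    refine Finset.sum_le_sum fun i _ => ?_
    rw [← mul_add, div_eq_mul_one_div]
    gcongr
    exact half_le_norm_sq_walshCoeff_add hg_odd hg i
  have hmain : ε / 2 * (S / 2) ≤ 2 * ((2 * C) ^ 2 * B + ε ^ 2 * (2 * C) ^ 2 * S) := by
    linarith [hrotation norm_one, hrotation Complex.norm_I,
      mul_le_mul_of_nonneg_left hlower (by positivity : 0 ≤ ε / 2)]
  have habsorb : ε / 2 * (S / 2) - 2 * (ε ^ 2 * (2 * C) ^ 2 * S) = S / (512 * C ^ 2) := by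
    simp only [ε]
    field_simp
    ring
  have hfinal : S / (512 * C ^ 2) ≤ 8 * C ^ 2 * B := by linarith
  rw [div_le_iff₀ (by positivity)] at hfinal
  linarith

end FatouZygmund

section Sidon

/-- The restriction of `t ↦ e^{imt}` to the grid `{2 * π * k / M}` of the circle, as a character of
`ℤ/M`. -/
def gridChar (M : ℕ) [NeZero M] (m : ℕ) : AddChar (ZMod M) ℂ :=
  ZMod.stdAddChar.mulShift (m : ZMod M)

lemma gridChar_add (M : ℕ) [NeZero M] (m n : ℕ) :
    gridChar M m + gridChar M n = gridChar M (m + n) := by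
  rw [gridChar, gridChar, gridChar, Nat.cast_add, ← AddChar.mulShift_mul]
  rfl

lemma gridChar_zero (M : ℕ) [NeZero M] : gridChar M 0 = 0 := by
  rw [gridChar, Nat.cast_zero, AddChar.mulShift_zero]
  rfl

lemma gridChar_injOn (M : ℕ) [NeZero M] : Set.InjOn (gridChar M) (Set.Iio M) := by
  intro m hm n hn h
  have hcast := AddChar.to_mulShift_inj_of_isPrimitive (ZMod.isPrimitive_stdAddChar M) h
  rwa [ZMod.natCast_eq_natCast_iff', Nat.mod_eq_of_lt hm, Nat.mod_eq_of_lt hn] at hcast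

lemma gridChar_ne_zero {M m : ℕ} [NeZero M] (hm : 0 < m) (hmM : m < M) : gridChar M m ≠ 0 := by
  rw [← gridChar_zero]
  exact (gridChar_injOn M).ne hmM (hm.trans hmM) hm.ne'

lemma gridChar_intCast (M m : ℕ) [NeZero M] (k : ℤ) :
    gridChar M m k = Complex.exp (Complex.I * m * (k * (2 * Real.pi / M) : ℝ)) := by
  rw [gridChar, AddChar.mulShift_apply, ← Int.cast_natCast m, ← Int.cast_mul, ZMod.stdAddChar_coe]
  push_cast
  ring_nf

lemma exists_int_abs_sub_le {h : ℝ} (hh : 0 < h) (t : ℝ) : ∃ k : ℤ, |t - k * h| ≤ h / 2 := by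
  refine ⟨round (t / h), ?_⟩
  calc |t - round (t / h) * h| = |t / h - round (t / h)| * h := by
        rw [← abs_of_pos hh, ← abs_mul, abs_of_pos hh, sub_mul, div_mul_cancel₀ t hh.ne']
    _ ≤ 1 / 2 * h := by gcongr; exact abs_sub_round _
    _ = h / 2 := by ring

lemma norm_exp_I_mul_sub_le (m : ℕ) (t u : ℝ) :
    ‖Complex.exp (Complex.I * m * t) - Complex.exp (Complex.I * m * u)‖ ≤ m * |t - u| := by
  have hfactor : Complex.exp (Complex.I * m * t) - Complex.exp (Complex.I * m * u) =
      Complex.exp ((m * u : ℝ) * Complex.I) *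
        (Complex.exp (Complex.I * (m * (t - u) : ℝ)) - 1) := by
    rw [mul_sub, ← Complex.exp_add, mul_one]
    push_cast
    ring_nf
  rw [hfactor, norm_mul, Complex.norm_exp_ofReal_mul_I, one_mul]
  refine Real.norm_exp_I_mul_ofReal_sub_one_le.trans_eq ?_
  rw [Real.norm_eq_abs, abs_mul, Nat.abs_cast]

lemma norm_sum_exp_le_norm_sum_gridChar_add {ι : Type*} [Fintype ι] (M : ℕ) [NeZero M]
    (l : ι → ℕ) (a : ι → ℂ) (t : ℝ) :
    ‖∑ j, a j * Complex.exp (Complex.I * l j * t)‖ ≤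
      ‖∑ j, a j • (gridChar M (l j) : ZMod M → ℂ)‖ + ∑ j, ‖a j‖ * (l j * Real.pi / M) := by
  have hM : (0 : ℝ) < M := Nat.cast_pos.mpr (NeZero.pos M)
  obtain ⟨k, hk⟩ := exists_int_abs_sub_le (h := 2 * Real.pi / M) (by positivity) t
  let u : ℝ := k * (2 * Real.pi / M)
  have htu : |t - u| ≤ Real.pi / M := hk.trans_eq (by ring)
  have hsplit : ∑ j, a j * Complex.exp (Complex.I * l j * t) =
      (∑ j, a j • (gridChar M (l j) : ZMod M → ℂ)) (k : ZMod M) +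
        ∑ j, a j * (Complex.exp (Complex.I * l j * t) - Complex.exp (Complex.I * l j * u)) := by
    simp only [Finset.sum_apply, Pi.smul_apply, smul_eq_mul, gridChar_intCast, mul_sub,
      Finset.sum_sub_distrib, u, add_sub_cancel]
  rw [hsplit]
  refine (norm_add_le _ _).trans (add_le_add (norm_le_pi_norm _ _) ?_)
  refine norm_sum_le_of_le _ fun j _ => ?_
  rw [norm_mul, mul_div_assoc]
  gcongr
  exact (norm_exp_I_mul_sub_le _ _ _).trans (by gcongr)

lemma sum_norm_le_two_mul_norm_sum_gridChar {ι : Type*} [Fintype ι] {l : ι → ℕ} {C : ℝ}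
    (hC0 : 0 < C) {a : ι → ℂ}
    (hC : ∑ j, ‖a j‖ ≤ C * ⨆ t : ℝ, ‖∑ j, a j * Complex.exp (Complex.I * l j * t)‖)
    {M : ℕ} [NeZero M] (hM : ∀ j, 2 * C * (l j * Real.pi) ≤ M) :
    ∑ j, ‖a j‖ ≤ 2 * C * ‖∑ j, a j • (gridChar M (l j) : ZMod M → ℂ)‖ := by
  have hM0 : (0 : ℝ) < M := Nat.cast_pos.mpr (NeZero.pos M)
  have herror : ∑ j, ‖a j‖ * (l j * Real.pi / M) ≤ (∑ j, ‖a j‖) * (1 / (2 * C)) := by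
    rw [Finset.sum_mul]
    refine Finset.sum_le_sum fun j _ => mul_le_mul_of_nonneg_left ?_ (norm_nonneg _)
    rw [div_le_div_iff₀ hM0 (by positivity)]
    linarith [hM j]
  have hsup : (⨆ t : ℝ, ‖∑ j, a j * Complex.exp (Complex.I * l j * t)‖) ≤
      ‖∑ j, a j • (gridChar M (l j) : ZMod M → ℂ)‖ + (∑ j, ‖a j‖) * (1 / (2 * C)) :=
    ciSup_le fun t => (norm_sum_exp_le_norm_sum_gridChar_add M l a t).trans (by gcongr)
  have h := hC.trans (mul_le_mul_of_nonneg_left hsup hC0.le)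
  have hhalf : C * ((∑ j, ‖a j‖) * (1 / (2 * C))) = (∑ j, ‖a j‖) / 2 := by field_simp
  linarith

namespace IsSidon

variable {l : ℕ → ℕ}

lemma injective (hl : IsSidon l) : Function.Injective l := by
  classical
  obtain ⟨C, -, hC⟩ := hl
  intro i j hij
  by_contra hne
  let a : ℕ → ℂ := Pi.single i 1 - Pi.single j 1
  have hcancel (t : ℝ) : ∑ k ∈ Finset.range (i + j + 1),
      a k * Complex.exp (Complex.I * (l k : ℂ) * (t : ℂ)) = 0 := by
    simp only [a, Pi.sub_apply, sub_mul, Finset.sum_sub_distrib, Pi.single_apply, ite_mul, one_mul,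
      zero_mul, Finset.sum_ite_eq', Finset.mem_range]
    rw [if_pos (by omega), if_pos (by omega), hij, sub_self]
  have h := hC (i + j + 1) a
  simp only [hcancel, norm_zero, ciSup_const, mul_zero] at h
  have ha_i : ‖a i‖ = 1 := by simp [a, hne]
  linarith [Finset.single_le_sum (fun k _ => norm_nonneg (a k))
    (Finset.mem_range.mpr (by omega : i < i + j + 1))]

lemma exists_sum_norm_le_norm_sum_gridChar (hl : IsSidon l) :
    ∃ C : ℝ, 1 ≤ C ∧ ∀ N, ∀ᶠ M in atTop, ∀ [NeZero M] (a : Fin N → ℂ),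
      ∑ j, ‖a j‖ ≤ C * ‖∑ j, a j • (gridChar M (l j) : ZMod M → ℂ)‖ := by
  obtain ⟨C, hC0, hC⟩ := hl
  refine ⟨max 1 (2 * C), le_max_left _ _, fun N => ?_⟩
  have hlarge : ∀ᶠ M : ℕ in atTop, ∀ j : Fin N, 2 * C * (l j * Real.pi) ≤ M :=
    eventually_all.mpr fun j => tendsto_natCast_atTop_atTop.eventually_ge_atTop _
  filter_upwards [hlarge] with M hM _ a
  have h := hC N fun j => if hj : j < N then a ⟨j, hj⟩ else 0
  simp only [Finset.sum_range, Fin.is_lt, dite_true, Fin.eta] at h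
  exact (sum_norm_le_two_mul_norm_sum_gridChar hC0 h hM).trans (by gcongr; exact le_max_right _ _)

lemma exists_sum_norm_le_of_neg_le_re (hl : IsSidon l) (hl_pos : ∀ j, 0 < l j) :
    ∃ K : ℝ, ∀ (N : ℕ) (a : ℕ → ℂ) (B : ℝ), 0 ≤ B →
      (∀ t : ℝ, -B ≤ (∑ j ∈ Finset.range N, a j * Complex.exp (Complex.I * l j * t)).re) →
      ∑ j ∈ Finset.range N, ‖a j‖ ≤ K * B := by
  obtain ⟨C, hC1, hC⟩ := hl.exists_sum_norm_le_norm_sum_gridChar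
  refine ⟨4096 * C ^ 4, fun N a B hB0 ha => ?_⟩
  have hlarge : ∀ᶠ M : ℕ in atTop, ∀ i j : Fin N, l i + l j < M :=
    eventually_all.mpr fun i => eventually_all.mpr fun j => eventually_gt_atTop _
  obtain ⟨M, hCM, hlM, hM⟩ := ((hC N).and (hlarge.and (eventually_gt_atTop 0))).exists
  have : NeZero M := ⟨hM.ne'⟩
  have hlM' : ∀ j : Fin N, l j < M := fun j => (Nat.le_add_right _ _).trans_lt (hlM j j)
  rw [Finset.sum_range]
  refine sum_norm_le_of_neg_le_re (χ := fun j : Fin N => gridChar M (l j)) (a := fun j => a j)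
    (fun i j hij => Fin.ext (hl.injective (gridChar_injOn M (hlM' i) (hlM' j) hij)))
    (fun i j => ?_) hC1 (fun a => hCM a) hB0 fun y => ?_
  · rw [gridChar_add]
    exact gridChar_ne_zero (Nat.add_pos_left (hl_pos i) _) (hlM i j)
  · obtain ⟨k, rfl⟩ := ZMod.intCast_surjective y
    simp only [gridChar_intCast]
    simpa only [Finset.sum_range] using ha (k * (2 * Real.pi / M))

lemma exists_tsum_norm_le_of_neg_le_re (hl : IsSidon l) (hl_pos : ∀ j, 0 < l j) :
    ∃ K : ℝ, ∀ (a : ℕ → ℂ) (B : ℝ), 0 ≤ B → Summable (fun j => ‖a j‖) →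
      (∀ t : ℝ, -B ≤ (∑' j, a j * Complex.exp (Complex.I * l j * t)).re) →
      ∑' j, ‖a j‖ ≤ K * B := by
  obtain ⟨K, hK⟩ := hl.exists_sum_norm_le_of_neg_le_re hl_pos
  refine ⟨K, fun a B hB0 ha_sum ha => ?_⟩
  let f (t : ℝ) (j : ℕ) : ℂ := a j * Complex.exp (Complex.I * l j * t)
  let tail (N : ℕ) : ℝ := ∑' j, ‖a (j + N)‖
  have hf_norm (t : ℝ) (j : ℕ) : ‖f t j‖ = ‖a j‖ := by
    have hexp : Complex.I * l j * t = (l j * t : ℝ) * Complex.I := by push_cast; ring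
    rw [norm_mul, hexp, Complex.norm_exp_ofReal_mul_I, mul_one]
  have htruncate (N : ℕ) (t : ℝ) :
      -(B + tail N) ≤ (∑ j ∈ Finset.range N, f t j).re := by
    have hf : Summable fun j => ‖f t j‖ := ha_sum.congr fun j => (hf_norm t j).symm
    have htail : ‖∑' j, f t (j + N)‖ ≤ tail N := by
      refine (norm_tsum_le_tsum_norm ?_).trans_eq (tsum_congr fun j => hf_norm t (j + N))
      exact (summable_nat_add_iff (f := fun j => ‖f t j‖) N).mpr hf
    have hsplit := congr_arg Complex.re (hf.of_norm.sum_add_tsum_nat_add N)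
    rw [Complex.add_re] at hsplit
    linarith [ha t, (Complex.re_le_norm _).trans htail]
  have hlimit : Tendsto (fun N => K * (B + tail N)) atTop (𝓝 (K * (B + 0))) :=
    ((tendsto_sum_nat_add fun j => ‖a j‖).const_add B).const_mul K
  rw [add_zero] at hlimit
  exact le_of_tendsto_of_tendsto' ha_sum.hasSum.tendsto_sum_nat hlimit fun N =>
    hK N a _ (add_nonneg hB0 (tsum_nonneg fun j => norm_nonneg _)) (htruncate N)

end IsSidon

end Sidon

section HalfPlaneExpansion

open UpperHalfPlane Function.Periodic
open scoped Manifold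

variable {h σ : ℝ} {f : ℍ → ℂ} {c : ℕ → ℂ}

lemma qExpansion_coeff_unique_of_le_im (hh : 0 < h) (hσ : 0 < σ) {c' : ℕ → ℂ}
    (hc : ∀ τ : ℍ, σ ≤ τ.im → HasSum (fun m => c m * qParam h τ ^ m) (f τ))
    (hc' : ∀ τ : ℍ, σ ≤ τ.im → HasSum (fun m => c' m * qParam h τ ^ m) (f τ)) : c = c' := by
  have hzero (τ : ℍ) : HasSum
      (fun m => ((c m - c' m) * qParam h (Complex.I * σ) ^ m) • qParam h τ ^ m)
      ((0 : ℍ → ℂ) τ) := by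
    let τ' : ℍ := ⟨Complex.I * σ + τ, by simpa using add_pos hσ τ.im_pos⟩
    have hτ' : σ ≤ τ'.im := by
      change σ ≤ (Complex.I * σ + τ : ℂ).im
      simpa using τ.im_pos.le
    have hparam : qParam h τ' = qParam h (Complex.I * σ) * qParam h τ := by
      change Complex.exp _ = _
      rw [qParam, qParam, ← Complex.exp_add]
      change Complex.exp (2 * Real.pi * Complex.I * (Complex.I * σ + τ : ℂ) / h) = _
      ring_nf
    have hsub := (hc τ' hτ').sub (hc' τ' hτ')
    simp only [hparam, mul_pow, ← mul_assoc, ← sub_mul, sub_self] at hsub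
    exact hsub
  have hanalytic : AnalyticAt ℂ (cuspFunction h (0 : ℍ → ℂ)) 0 :=
    analyticAt_cuspFunction_zero hh (fun _ => rfl)
      (UpperHalfPlane.mdifferentiable_iff.mpr (differentiableOn_const 0))
      (isBoundedAtImInfty_of_hasSum_qExpansion hh hzero)
  funext m
  have hm := qExpansion_coeff_unique (0 : C(ℍ, ℂ)) hh hanalytic hzero m
  rw [ContinuousMap.coe_zero, qExpansion_zero, map_zero, mul_eq_zero] at hm
  exact sub_eq_zero.mp (hm.resolve_right (pow_ne_zero m (qParam_ne_zero _)))

lemma isBoundedAtImInfty_of_hasSum_of_le_im (hh : 0 < h) (hσ : 0 < σ)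
    (hc : ∀ τ : ℍ, σ ≤ τ.im → HasSum (fun m => c m * qParam h τ ^ m) (f τ)) :
    IsBoundedAtImInfty f := by
  let τσ : ℍ := ⟨Complex.I * σ, by simpa using hσ⟩
  have hτσ : τσ.im = σ := by simp [τσ, UpperHalfPlane.im]
  refine isBoundedAtImInfty_iff.mpr ⟨∑' m, ‖c m * qParam h τσ ^ m‖, σ, fun τ hτ => ?_⟩
  rw [← (hc τ hτ).tsum_eq]
  refine tsum_of_norm_bounded (hc τσ hτσ.ge).summable.norm.hasSum fun m => ?_
  have hnorm : ‖qParam h τ‖ ≤ ‖qParam h τσ‖ := by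
    rw [norm_qParam, norm_qParam, coe_im, coe_im, hτσ]
    simp only [neg_mul]
    gcongr
  rw [norm_mul, norm_mul, norm_pow, norm_pow]
  gcongr

lemma periodic_comp_ofComplex_of_hasSum_of_le_im (hh : 0 < h) (hf : MDiff f)
    (hc : ∀ τ : ℍ, σ ≤ τ.im → HasSum (fun m => c m * qParam h τ ^ m) (f τ)) :
    Function.Periodic (f ∘ ofComplex) h := by
  have hf_diff := UpperHalfPlane.mdifferentiable_iff.mp hf
  have hmaps : Set.MapsTo (fun z : ℂ => z + h) {z | 0 < z.im} {z | 0 < z.im} := by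
    intro z hz
    simpa using hz
  have hmem : Complex.I * (|σ| + 1 : ℝ) ∈ {z : ℂ | |σ| < z.im} := by simp
  have hfar : (f ∘ ofComplex) ∘ (· + (h : ℂ)) =ᶠ[𝓝 (Complex.I * (|σ| + 1 : ℝ))]
      f ∘ ofComplex := by
    filter_upwards [(isOpen_lt continuous_const Complex.continuous_im).mem_nhds hmem] with z hz
    have hz0 : 0 < z.im := (abs_nonneg σ).trans_lt hz
    have hσz : σ ≤ z.im := (le_abs_self σ).trans hz.le
    have hz0' : 0 < (z + h).im := hmaps hz0
    simp only [Function.comp_apply, ofComplex_apply_of_im_pos hz0,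
      ofComplex_apply_of_im_pos hz0']
    have hparam : qParam h (z + h) = qParam h z := by
      rw [qParam, qParam, mul_add, add_div, mul_div_cancel_right₀ _ (by exact_mod_cast hh.ne'),
        Complex.exp_periodic]
    refine (hc _ (by simpa using hσz)).unique ?_
    simpa only [hparam] using hc ⟨z, hz0⟩ hσz
  intro z
  rcases le_or_gt z.im 0 with hz | hz
  · simp [ofComplex_apply_eq_of_im_nonpos (w := z + h) (by simpa using hz) hz]
  · exact ((hf_diff.comp (by fun_prop) hmaps).analyticOnNhd isOpen_upperHalfPlaneSet)
      |>.eqOn_of_preconnected_of_eventuallyEq (hf_diff.analyticOnNhd isOpen_upperHalfPlaneSet)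
        (convex_halfSpace_im_gt 0).isPreconnected ((abs_nonneg σ).trans_lt hmem) hfar hz

theorem hasSum_qParam_of_le_im (hh : 0 < h) (hf : MDiff f)
    (hc : ∀ τ : ℍ, σ ≤ τ.im → HasSum (fun m => c m * qParam h τ ^ m) (f τ)) (τ : ℍ) :
    HasSum (fun m => c m * qParam h τ ^ m) (f τ) := by
  replace hc (τ : ℍ) (hτ : max σ 1 ≤ τ.im) := hc τ ((le_max_left _ _).trans hτ)
  have hmax : 0 < max σ 1 := by positivity
  have hexpansion := hasSum_qExpansion hh
    (periodic_comp_ofComplex_of_hasSum_of_le_im hh hf hc) hf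
    (isBoundedAtImInfty_of_hasSum_of_le_im hh hmax hc)
  rw [qExpansion_coeff_unique_of_le_im hh hmax hc fun τ _ => hexpansion τ]
  exact hexpansion τ

end HalfPlaneExpansion

theorem hasSum_exp_pow_of_hasSum_of_le_re {ψ : ℂ → ℂ} {κ σ : ℝ} {e : ℕ → ℂ} (hκ : 0 < κ)
    (hψ : DifferentiableOn ℂ ψ rightHalfPlane)
    (he : ∀ s : ℂ, σ ≤ s.re → HasSum (fun k => e k * Complex.exp (-s * κ) ^ k) (ψ s))
    {s : ℂ} (hs : s ∈ rightHalfPlane) :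
    HasSum (fun k => e k * Complex.exp (-s * κ) ^ k) (ψ s) := by
  have hparam (z : ℂ) :
      Function.Periodic.qParam (2 * Real.pi / κ) z = Complex.exp (-(-Complex.I * z) * κ) := by
    rw [Function.Periodic.qParam]
    congr 1
    push_cast
    field_simp
  have hrotate (z : ℂ) : (-Complex.I * z).re = z.im := by simp
  let f : UpperHalfPlane → ℂ := fun τ => ψ (-Complex.I * τ)
  have hf : MDifferentiable (modelWithCornersSelf ℂ ℂ) (modelWithCornersSelf ℂ ℂ) f := by
    refine UpperHalfPlane.mdifferentiable_iff.mpr ?_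
    refine (hψ.comp (f := fun z : ℂ => -Complex.I * z) (by fun_prop) fun z hz => ?_).congr
      fun z hz => ?_
    · simpa [rightHalfPlane] using hz
    · simp [f, UpperHalfPlane.ofComplex_apply_of_im_pos hz]
  have hs' : 0 < (Complex.I * s).im := Complex.I_mul_im s ▸ hs
  have hsum := hasSum_qParam_of_le_im (h := 2 * Real.pi / κ) (by positivity) hf
    (fun τ hτ => by
      rw [hparam]
      exact he _ (by simpa only [hrotate, UpperHalfPlane.coe_im] using hτ)) ⟨Complex.I * s, hs'⟩
  have hback : -Complex.I * (Complex.I * s) = s := by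
    rw [← mul_assoc, neg_mul, Complex.I_mul_I, neg_neg, one_mul]
  simpa only [hparam, f, hback] using hsum

theorem hasSum_exp_pow_of_tendsto {l : ℕ → ℕ} {d : ℕ → ℂ} {κ : ℝ} {c₁ : ℂ} {ψ : ℂ → ℂ}
    (hl : Function.Injective l) (hκ : 0 < κ)
    (hψ : DifferentiableOn ℂ ψ rightHalfPlane)
    (h : ∃ σ : ℝ, ∀ s : ℂ, σ < s.re → Tendsto
      (fun N => c₁ + ∑ j ∈ Finset.range N, d j * Complex.exp (-s * (l j * κ : ℝ)))
      atTop (𝓝 (ψ s))) {s : ℂ} (hs : s ∈ rightHalfPlane) :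
    HasSum (fun j => d j * Complex.exp (-s * κ) ^ l j) (ψ s - c₁) := by
  have hsummable : Summable fun j => Real.exp (-1 * (l j * κ)) := by
    refine ((Real.summable_exp_nat_mul_of_ge (c := -κ) (by simpa) (f := fun i => i)
      fun _ => le_rfl).comp_injective hl).congr fun j => ?_
    simp [mul_comm]
  have hexp (s : ℂ) (j : ℕ) :
      Complex.exp (-s * (l j * κ : ℝ)) = Complex.exp (-s * κ) ^ l j := by
    rw [← Complex.exp_nat_mul]
    push_cast
    ring_nf
  have hextend (w S : ℂ) : HasSum (fun k => Function.extend l d 0 k * w ^ k) S ↔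
      HasSum (fun j => d j * w ^ l j) S := by
    rw [← hl.hasSum_iff fun k hk => by simp [Function.extend_apply' _ _ _ hk]]
    simp [Function.comp_def, hl.extend_apply]
  obtain ⟨σ, hσ⟩ := exists_forall_hasSum_exp_of_tendsto (fun j => by positivity) hsummable h
  simp only [hexp, ← hextend] at hσ ⊢
  exact hasSum_exp_pow_of_hasSum_of_le_re hκ (hψ.sub_const c₁) hσ hs

namespace IsSidon

variable {l : ℕ → ℕ} {d : ℕ → ℂ}

theorem summable_norm_of_neg_le_re (hl : IsSidon l) (hl_pos : ∀ j, 0 < l j) {B ρ₀ : ℝ}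
    (hρ₀ : ρ₀ < 1) (hd : ∀ w : ℂ, ‖w‖ < 1 → Summable fun j => d j * w ^ l j)
    (hB : ∀ w : ℂ, ρ₀ < ‖w‖ → ‖w‖ < 1 → -B ≤ (∑' j, d j * w ^ l j).re) :
    Summable fun j => ‖d j‖ := by
  obtain ⟨K, hK⟩ := hl.exists_tsum_norm_le_of_neg_le_re hl_pos
  have hcircle {ρ : ℝ} (hρ₀ρ : max ρ₀ 0 < ρ) (hρ1 : ρ < 1) (N : ℕ) :
      ∑ j ∈ Finset.range N, ‖d j‖ * ρ ^ l j ≤ K * |B| := by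
    obtain ⟨hρ₀ρ, hρ⟩ := max_lt_iff.mp hρ₀ρ
    have hnorm (j : ℕ) : ‖d j * (ρ : ℂ) ^ l j‖ = ‖d j‖ * ρ ^ l j := by simp [abs_of_pos hρ]
    have hsummable : Summable fun j => ‖d j * (ρ : ℂ) ^ l j‖ :=
      (hd ρ (by simpa [abs_of_pos hρ] using hρ1)).norm
    have hpolar (t : ℝ) (j : ℕ) : d j * (ρ : ℂ) ^ l j * Complex.exp (Complex.I * l j * t) =
        d j * (ρ * Complex.exp (t * Complex.I)) ^ l j := by
      rw [mul_pow, ← Complex.exp_nat_mul, mul_assoc]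
      ring_nf
    have hnorm_polar (t : ℝ) : ‖(ρ : ℂ) * Complex.exp (t * Complex.I)‖ = ρ := by
      simp [abs_of_pos hρ, Complex.norm_exp_ofReal_mul_I]
    have htsum := hK (fun j => d j * (ρ : ℂ) ^ l j) |B| (abs_nonneg B) hsummable fun t => by
      simp only [hpolar]
      exact (neg_le_neg (le_abs_self B)).trans
        (hB _ (by rwa [hnorm_polar]) (by rwa [hnorm_polar]))
    simp only [← hnorm]
    exact (hsummable.sum_le_tsum _ fun _ _ => norm_nonneg _).trans htsum
  refine summable_of_sum_range_le (c := K * |B|) (fun _ => norm_nonneg _) fun N => ?_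
  have hlim : Tendsto (fun ρ : ℝ => ∑ j ∈ Finset.range N, ‖d j‖ * ρ ^ l j) (𝓝[<] 1)
      (𝓝 (∑ j ∈ Finset.range N, ‖d j‖)) := by
    have hcont : Continuous fun ρ : ℝ => ∑ j ∈ Finset.range N, ‖d j‖ * ρ ^ l j := by fun_prop
    simpa using hcont.continuousWithinAt (s := Set.Iio 1) (x := 1) |>.tendsto
  refine le_of_tendsto hlim ?_
  filter_upwards [Ioo_mem_nhdsLT (max_lt hρ₀ one_pos)] with ρ hρ using hcircle hρ.1 hρ.2 N

theorem summable_norm_of_neg_le_re_of_re_le_one (hl : IsSidon l) (hl_pos : ∀ j, 0 < l j)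
    {κ B : ℝ} (hκ : 0 < κ) {c₁ : ℂ} {ψ : ℂ → ℂ} (hψ : DifferentiableOn ℂ ψ rightHalfPlane)
    (hB : ∀ s ∈ rightHalfPlane, s.re ≤ 1 → -B ≤ (ψ s).re)
    (h : ∃ σ : ℝ, ∀ s : ℂ, σ < s.re → Tendsto
      (fun N => c₁ + ∑ j ∈ Finset.range N, d j * Complex.exp (-s * (l j * κ : ℝ)))
      atTop (𝓝 (ψ s))) :
    Summable fun j => ‖d j‖ := by
  have hsurj {w : ℂ} (hw : w ≠ 0) : ∃ s : ℂ, Complex.exp (-s * κ) = w := by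
    refine ⟨-Complex.log w / κ, ?_⟩
    rw [neg_div, neg_neg, div_mul_cancel₀ _ (by exact_mod_cast hκ.ne'), Complex.exp_log hw]
  have hnorm (s : ℂ) : ‖Complex.exp (-s * κ)‖ = Real.exp (-s.re * κ) := by
    simp [Complex.norm_exp]
  have hmem {s : ℂ} (hs : ‖Complex.exp (-s * κ)‖ < 1) : s ∈ rightHalfPlane := by
    rw [hnorm, Real.exp_lt_one_iff, neg_mul, neg_lt_zero] at hs
    exact pos_of_mul_pos_left hs hκ.le
  refine hl.summable_norm_of_neg_le_re hl_pos (B := B + ‖c₁‖) (ρ₀ := Real.exp (-κ))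
    (by simpa using hκ) (fun w hw => ?_) fun w hρ₀ hw => ?_
  · rcases eq_or_ne w 0 with rfl | hw0
    · simp [(hl_pos _).ne']
    obtain ⟨s, rfl⟩ := hsurj hw0
    exact (hasSum_exp_pow_of_tendsto hl.injective hκ hψ h (hmem hw)).summable
  · obtain ⟨s, rfl⟩ := hsurj (norm_pos_iff.mp ((Real.exp_pos _).trans hρ₀))
    have hs_le : s.re ≤ 1 := by
      rw [hnorm, Real.exp_lt_exp] at hρ₀
      nlinarith
    rw [(hasSum_exp_pow_of_tendsto hl.injective hκ hψ h (hmem hw)).tsum_eq, Complex.sub_re]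
    linarith [hB s (hmem hw) hs_le, Complex.re_le_norm c₁]

end IsSidon

theorem proposition2p5_general (φ ψ : ℂ → ℂ) (c₀ : ℕ) (c₁ : ℂ) (d : ℕ → ℂ)
    (hψ : DifferentiableOn ℂ ψ rightHalfPlane)
    (hφ : ∀ s ∈ rightHalfPlane, φ s = c₀ * s + ψ s)
    (hφ_nonconst : ¬ ∃ w : ℂ, ∀ s ∈ rightHalfPlane, φ s = w) :
    (∀ q : ℕ → ℕ, MultiplicativelyIndependent q →
      (∃ σ : ℝ, ∀ s : ℂ, σ < s.re → Tendsto
        (fun N : ℕ => c₁ + ∑ j ∈ Finset.range N, d j * (q j : ℂ) ^ (-s)) atTop (𝓝 (ψ s))) →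
      (BoundedComposition φ → Summable (fun j => ‖d j‖) ∧ ∑' j, ‖d j‖ ≤ c₁.re) ∧
      (CompactComposition φ → Summable (fun j => ‖d j‖) ∧ ∑' j, ‖d j‖ < c₁.re)) ∧
    (∀ (r : ℝ) (l : ℕ → ℕ), 1 < r → (∀ j, 0 < l j) → IsSidon l →
      (∃ σ : ℝ, ∀ s : ℂ, σ < s.re → Tendsto
        (fun N : ℕ => c₁ + ∑ j ∈ Finset.range N, d j * (r : ℂ) ^ (-((l j : ℂ) * s)))
        atTop (𝓝 (ψ s))) →
      (∀ s ∈ rightHalfPlane, 0 ≤ (φ s).re) → Summable (fun j => ‖d j‖)) := by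
  refine ⟨fun q hq h => ?_, fun r l hr hl_pos hl h hφ_re => ?_⟩
  · lift q to ℕ → ℕ+ using fun j => zero_lt_two.trans_le (hq.two_le j)
    exact ⟨hq.tsum_norm_le_re_of_boundedComposition hφ h,
      hq.tsum_norm_lt_re_of_compactComposition hψ hφ hφ_nonconst h⟩
  · have hcpow (s : ℂ) (j : ℕ) :
        (r : ℂ) ^ (-((l j : ℂ) * s)) = Complex.exp (-s * (l j * Real.log r : ℝ)) := by
      rw [Complex.cpow_def_of_ne_zero (by exact_mod_cast (one_pos.trans hr).ne'),
        ← Complex.ofReal_log (one_pos.trans hr).le]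
      push_cast
      ring_nf
    simp only [hcpow] at h
    refine hl.summable_norm_of_neg_le_re_of_re_le_one hl_pos (Real.log_pos hr) hψ (B := c₀)
      (fun s hs hs_le => ?_) h
    have hφs := hφ_re s hs
    rw [hφ s hs, Complex.add_re, ← Complex.ofReal_natCast, Complex.re_ofReal_mul] at hφs
    linarith [mul_le_of_le_one_right (Nat.cast_nonneg (α := ℝ) c₀) hs_le]

theorem proposition2p5 (φ ψ : ℂ → ℂ) (c₀ : ℕ) (c₁ : ℂ) (d : ℕ → ℂ)
    (hψ : ψ ∈ convergentDirichlet)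
    (hφ : ∀ s ∈ rightHalfPlane, φ s = (c₀ : ℂ) * s + ψ s)
    (hφ_nonconst : ¬ ∃ w : ℂ, ∀ s ∈ rightHalfPlane, φ s = w) :
    (∀ q : ℕ → ℕ, 2 ≤ q 0 → StrictMono q → MultiplicativelyIndependent q →
      (∃ σ : ℝ, ∀ s : ℂ, σ < s.re →
        Tendsto (fun N : ℕ => c₁ + ∑ j ∈ Finset.range N, d j * (q j : ℂ) ^ (-s))
          atTop (𝓝 (ψ s))) →
      (BoundedComposition φ → Summable (fun j => ‖d j‖) ∧ ∑' j, ‖d j‖ ≤ c₁.re) ∧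
      (CompactComposition φ → Summable (fun j => ‖d j‖) ∧ ∑' j, ‖d j‖ < c₁.re)) ∧
    (∀ (r : ℕ) (l : ℕ → ℕ), 2 ≤ r → (∀ j, 0 < l j) → IsSidon l →
      (∃ σ : ℝ, ∀ s : ℂ, σ < s.re →
        Tendsto (fun N : ℕ => c₁ + ∑ j ∈ Finset.range N, d j * (r : ℂ) ^ (-((l j : ℂ) * s)))
          atTop (𝓝 (ψ s))) →
      BoundedComposition φ → Summable (fun j => ‖d j‖)) := by
  obtain ⟨hindep, hsidon⟩ := proposition2p5_general φ ψ c₀ c₁ d hψ.1 hφ hφ_nonconst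
  exact ⟨fun q _ _ => hindep q, fun r l hr hl_pos hl h hb =>
    hsidon r l (by exact_mod_cast hr) hl_pos hl (by simpa using h) fun _ => hb.re_nonneg⟩

end
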